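/- Let $A=\{a,b,c,d,p,q\}$ be real parameters with $ad-bc=1$ and $b\neq 0$. For $x,\omega\in\mathbb R$ and a function $f$ on $\mathbb{R}$ define the $A$-translation and the $A$-modulation by $$T_x^Af(t)=e^{-\frac{2\pi i a}{b}x(t-x)}f(t-x),\qquad M_\omega^Af(t)=e^{\frac{\pi i}{b}(a\omega^2-2p\omega+2\omega t)}f(t),$$ and extend both to the space $S'(\mathbb R)$ of tempered distributions by transposition with respect to the bilinear pairing. For $\Lambda\in S'(\mathbb R)$ and $\phi\in S(\mathbb R)$ let $$(\Lambda\star_A\phi)(x)=\frac{e^{-\frac{2\pi i a}{b}x^2}}{\sqrt{|b|}}\,\Lambda\big(C_{\frac{2a}{b}}T_x^A\phi^{\checkmark}\big),\qquad C_sf(t)=e^{\pi i s t^2}f(t),\quad \phi^{\checkmark}(t)=\phi(-t).$$ A weight on $\mathbb R^2$ is a measurable function with values in $(0,\infty)$. A weight $\nu$ is submultiplicative if $\nu(z+w)\le\nu(z)\nu(w)$ for all $z,w\in\mathbb{R}^2$; a weight $m$ is moderate if there are a submultiplicative weight $\nu$ and $C>0$ with $m(z+w)\le C\,m(z)\,\nu(w)$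 for all $z,w$; and $m$ has polynomial growth if $m(x,\omega)\le C(1+|x|+|\omega|)^s$ for some $C>0$ and $s\ge 0$. Let $v$ be a moderate weight of polynomial growth (for example a submultiplicative weight of polynomial growth). Fix a window $0\ne g\in S(\mathbb R)$ and put $$\boldsymbol M^1_{A,v}=\{f\in S'(\mathbb R):\|f\|_{\boldsymbol M^1_{A,v}}<\infty\},\qquad \|f\|_{\boldsymbol M^1_{A,v}}=\int_{\mathbb R}\int_{\mathbb R}|f\star_AM_\omega^Ag(x)|\,v(x,\omega)\,dx\,d\omega .$$ **Theorem (minimality of $\boldsymbol M^1_{A,v}$).** Let $\mathcal B$ be a complex Banach space continuously embedded into $S'(\mathbb R)$ such that (i) $\mathcal B$ is invariant under $A$-time-frequency shifts, and $\|M_\omega^AT_x^Af\|_{\mathcal B}\le v(x,\omega)\|f\|_{\mathcal B}$ for all $f\in\mathcal B$ and $x,\omega\in\mathbb R$; (ii) $\boldsymbol M^1_{A,v}\cap\mathcal B\ne\{0\}$. Then $\boldsymbol M^1_{A,v}$ is continuously embedded in $\mathcal B$: $\boldsymbol M^1_{A,v}\subseteq\mathcal B$, and there is $C>0$ with $\|f\|_{\mathcal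 B}\le C\|f\|_{\boldsymbol M^1_{A,v}}$ for all $f\in\boldsymbol M^1_{A,v}$. -/

import Mathlib

open scoped SchwartzMap ENNReal

noncomputable section

namespace SAFT

/-- The parameters `A = {a, b, c, d, p, q}` of a special affine Fourier transform:
real numbers with `a d - b c = 1` and `b ≠ 0`. -/
structure Params where
  a : ℝ
  b : ℝ
  c : ℝ
  d : ℝ
  p : ℝ
  q : ℝ
  det_eq_one : a * d - b * c = 1
  b_ne_zero : b ≠ 0

/-- The unimodular function `t ↦ exp (i (α t² + β t + γ))`. -/
def phase (α β γ : ℝ) (t : ℝ) : ℂ :=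
  Complex.exp (((α * t ^ 2 + β * t + γ : ℝ) : ℂ) * Complex.I)

theorem hasTemperateGrowth_exp_I :
    Function.HasTemperateGrowth (fun u : ℝ ↦ Complex.exp ((u : ℂ) * Complex.I)) := by
  have hd : ∀ n : ℕ, iteratedDeriv n (fun u : ℝ ↦ Complex.exp ((u : ℂ) * Complex.I)) =
      fun u : ℝ ↦ Complex.I ^ n * Complex.exp ((u : ℂ) * Complex.I) := by
    intro n
    induction n with
    | zero => simp
    | succ n ih =>
      rw [iteratedDeriv_succ, ih]
      funext u
      have h1 : HasDerivAt (fun u : ℝ ↦ (u : ℂ) * Complex.I) (1 * Complex.I) u :=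
        (Complex.ofRealCLM.hasDerivAt (x := u)).mul_const Complex.I
      have h2 := (h1.cexp).const_mul (Complex.I ^ n)
      rw [h2.deriv]
      ring
  refine ⟨?_, fun n ↦ ⟨0, 1, fun u ↦ ?_⟩⟩
  · exact ((Complex.ofRealCLM.contDiff).mul contDiff_const).cexp
  · rw [norm_iteratedFDeriv_eq_norm_iteratedDeriv, hd]
    simp [Complex.norm_exp]

theorem hasTemperateGrowth_phase (α β γ : ℝ) : (phase α β γ).HasTemperateGrowth := by
  have hp : Function.HasTemperateGrowth (fun t : ℝ ↦ α * t ^ 2 + β * t + γ) := by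
    have hid : Function.HasTemperateGrowth (fun t : ℝ ↦ t) := Function.HasTemperateGrowth.id'
    exact (((Function.HasTemperateGrowth.const α).mul (hid.pow 2)).add
      ((Function.HasTemperateGrowth.const β).mul hid)).add (Function.HasTemperateGrowth.const γ)
  exact hasTemperateGrowth_exp_I.comp hp

/-- Pointwise multiplication by `phase α β γ` on the Schwartz space. -/
def mulPhase (α β γ : ℝ) : 𝓢(ℝ, ℂ) →L[ℂ] 𝓢(ℝ, ℂ) :=
  SchwartzMap.smulLeftCLM ℂ (phase α β γ)

theorem mulPhase_apply (α β γ : ℝ) (φ : 𝓢(ℝ, ℂ)) (t : ℝ) :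
    mulPhase α β γ φ t = phase α β γ t * φ t := by
  simp [mulPhase, SchwartzMap.smulLeftCLM_apply_apply (hasTemperateGrowth_phase α β γ)]

/-- The chirp modulation `C_s φ (t) = exp (π i s t²) φ (t)` on the Schwartz space. -/
def chirp (s : ℝ) : 𝓢(ℝ, ℂ) →L[ℂ] 𝓢(ℝ, ℂ) :=
  mulPhase (Real.pi * s) 0 0

theorem chirp_apply (s : ℝ) (φ : 𝓢(ℝ, ℂ)) (t : ℝ) :
    chirp s φ t = Complex.exp (Real.pi * Complex.I * s * t ^ 2) * φ t := by
  simp only [chirp, mulPhase_apply, phase]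
  congr 2
  push_cast
  ring

/-- The involution `φ ↦ φ(-·)` on the Schwartz space. -/
def reflection : 𝓢(ℝ, ℂ) →L[ℂ] 𝓢(ℝ, ℂ) :=
  SchwartzMap.compCLMOfContinuousLinearEquiv ℂ (ContinuousLinearEquiv.neg ℝ)

theorem reflection_apply (φ : 𝓢(ℝ, ℂ)) (t : ℝ) : reflection φ t = φ (-t) := by
  simp [reflection]

/-- The `A`-translation `T_s^A φ (t) = exp (-(2 π i a / b) s (t - s)) φ (t - s)` on the
Schwartz space. -/
def translation (A : Params) (s : ℝ) : 𝓢(ℝ, ℂ) →L[ℂ] 𝓢(ℝ, ℂ) :=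
  (SchwartzMap.compSubConstCLM ℂ s).comp (mulPhase 0 (-(2 * Real.pi * A.a / A.b) * s) 0)

theorem translation_apply (A : Params) (s : ℝ) (φ : 𝓢(ℝ, ℂ)) (t : ℝ) :
    translation A s φ t =
      Complex.exp (-(2 * Real.pi * Complex.I * A.a / A.b) * s * (t - s)) * φ (t - s) := by
  simp only [translation, ContinuousLinearMap.comp_apply, SchwartzMap.compSubConstCLM_apply,
    mulPhase_apply, phase]
  congr 2
  push_cast
  ring

/-- The `A`-modulation `M_s^A φ (t) = exp ((π i / b) (a s² - 2 p s + 2 s t)) φ (t)` on the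
Schwartz space. -/
def modulation (A : Params) (s : ℝ) : 𝓢(ℝ, ℂ) →L[ℂ] 𝓢(ℝ, ℂ) :=
  mulPhase 0 (2 * Real.pi * s / A.b) (Real.pi / A.b * (A.a * s ^ 2 - 2 * A.p * s))

theorem modulation_apply (A : Params) (s : ℝ) (φ : 𝓢(ℝ, ℂ)) (t : ℝ) :
    modulation A s φ t =
      Complex.exp (Real.pi * Complex.I / A.b * (A.a * s ^ 2 - 2 * A.p * s + 2 * s * t)) *
        φ t := by
  simp only [modulation, mulPhase_apply, phase]
  congr 2
  push_cast
  ring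

/-- The `A`-translation on tempered distributions, by transposition:
`(T_s^A Λ)(φ) = Λ (t ↦ exp (-(2 π i a / b) s t) φ (t + s))`. -/
def translationDist (A : Params) (s : ℝ) : 𝓢'(ℝ, ℂ) →L[ℂ] 𝓢'(ℝ, ℂ) :=
  PointwiseConvergenceCLM.precomp ℂ
    ((mulPhase 0 (-(2 * Real.pi * A.a / A.b) * s) 0).comp (SchwartzMap.compSubConstCLM ℂ (-s)))

/-- The `A`-modulation on tempered distributions, by transposition:
`(M_s^A Λ)(φ) = Λ (M_s^A φ)`. -/
def modulationDist (A : Params) (s : ℝ) : 𝓢'(ℝ, ℂ) →L[ℂ] 𝓢'(ℝ, ℂ) :=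
  PointwiseConvergenceCLM.precomp ℂ (modulation A s)

/-- The `A`-translation of distributions extends that of Schwartz functions. -/
theorem translationDist_coe (A : Params) (s : ℝ) (f : 𝓢(ℝ, ℂ)) :
    translationDist A s (f : 𝓢'(ℝ, ℂ)) = (translation A s f : 𝓢'(ℝ, ℂ)) := by
  ext φ
  change SchwartzMap.toTemperedDistributionCLM ℝ ℂ MeasureTheory.volume f
    (mulPhase 0 (-(2 * Real.pi * A.a / A.b) * s) 0 (SchwartzMap.compSubConstCLM ℂ (-s) φ)) = _
  simp only [SchwartzMap.toTemperedDistributionCLM_apply_apply]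
  rw [← MeasureTheory.integral_sub_right_eq_self _ s]
  congr 1
  funext t
  simp only [mulPhase_apply, translation, ContinuousLinearMap.comp_apply,
    SchwartzMap.compSubConstCLM_apply, smul_eq_mul, sub_neg_eq_add, sub_add_cancel]
  ring

/-- The `A`-modulation of distributions extends that of Schwartz functions. -/
theorem modulationDist_coe (A : Params) (s : ℝ) (f : 𝓢(ℝ, ℂ)) :
    modulationDist A s (f : 𝓢'(ℝ, ℂ)) = (modulation A s f : 𝓢'(ℝ, ℂ)) := by
  ext φ
  change SchwartzMap.toTemperedDistributionCLM ℝ ℂ MeasureTheory.volume f (modulation A s φ) = _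
  simp only [SchwartzMap.toTemperedDistributionCLM_apply_apply]
  congr 1
  funext t
  simp only [modulation, mulPhase_apply, smul_eq_mul]
  ring

/-- The `A`-convolution of a tempered distribution with a Schwartz function,
`(Λ ⋆_A φ)(x) = |b|^{-1/2} exp (-(2 π i a / b) x²) Λ (C_{2a/b} T_x^A φ(-·))`. -/
def conv (A : Params) (Λ : 𝓢'(ℝ, ℂ)) (φ : 𝓢(ℝ, ℂ)) (x : ℝ) : ℂ :=
  Complex.exp (-(2 * Real.pi * Complex.I * A.a / A.b) * x ^ 2) * (1 / (Real.sqrt |A.b| : ℂ)) *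
    Λ (chirp (2 * A.a / A.b) (translation A x (reflection φ)))

/-- A weight function on `ℝ²`: measurable and strictly positive. -/
structure IsWeight (m : ℝ × ℝ → ℝ) : Prop where
  measurable : Measurable m
  pos : ∀ z, 0 < m z

/-- Submultiplicativity on `ℝ²`. -/
def IsSubmultiplicative (ν : ℝ × ℝ → ℝ) : Prop :=
  ∀ z w, ν (z + w) ≤ ν z * ν w

/-- `m` is moderate: `m (z + w) ≤ C m (z) ν (w)` for some submultiplicative weight `ν` and
some `C > 0`. -/
def IsModerate (m : ℝ × ℝ → ℝ) : Prop :=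
  ∃ ν : ℝ × ℝ → ℝ, IsWeight ν ∧ IsSubmultiplicative ν ∧
    ∃ C : ℝ, 0 < C ∧ ∀ z w, m (z + w) ≤ C * m z * ν w

/-- `m` has polynomial growth: `m (x, ω) ≤ C (1 + |x| + |ω|)^s` for some `C > 0`, `s ≥ 0`. -/
def HasPolynomialGrowth (m : ℝ × ℝ → ℝ) : Prop :=
  ∃ C s : ℝ, 0 < C ∧ 0 ≤ s ∧ ∀ x ω : ℝ, m (x, ω) ≤ C * (1 + |x| + |ω|) ^ s

/-- The norm of the `A`-modulation space `M^{r,s}_{A,m}` with respect to the window `g`,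
`(∫ (∫ |f ⋆_A M_ω^A g (x)|^r m(x, ω)^r dx)^{s/r} dω)^{1/s}`, with values in `[0, ∞]`. -/
def modNorm (A : Params) (m : ℝ × ℝ → ℝ) (g : 𝓢(ℝ, ℂ)) (r s : ℝ) (f : 𝓢'(ℝ, ℂ)) : ℝ≥0∞ :=
  (∫⁻ ω : ℝ, (∫⁻ x : ℝ, ‖conv A f (modulation A ω g) x‖ₑ ^ r *
    ENNReal.ofReal (m (x, ω)) ^ r) ^ (s / r)) ^ (1 / s)

/-- The `A`-modulation space `M^{r,s}_{A,m}` with respect to the window `g`. -/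
def modSpace (A : Params) (m : ℝ × ℝ → ℝ) (g : 𝓢(ℝ, ℂ)) (r s : ℝ) : Set 𝓢'(ℝ, ℂ) :=
  {f | modNorm A m g r s f < ∞}

end SAFT

end

open SAFT

open MeasureTheory Filter Topology

/-! ### Schwartz-valued integrals and tempered distributions. -/

namespace SchwartzMap

/-! Up to unimodular factors, `A`-time-frequency shifts are ordinary shifts by `(x, ξ)` with `ξ = (a
x - ω) / b`, and `f ⋆_A M_ω^A g` is an ordinary short-time Fourier transform of `f` at the same
point. The statement thus concerns weighted `L¹` norms of such transforms and operators `S z` on `B`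
that realise the ordinary shifts.

Let `f₀ = ι u₀` be the common non-zero element and choose `h` with `f₀ h = 1`. The orthogonality
relation `integral_stft_mul_apply_tfShiftInv` says that, weakly, `f = ∫ f (tfShift z h) • S z u₀
dz`. If this were a Bochner integral in `B`, its norm would be at most the weighted norm of `f`, and
the theorem would follow. However, nothing makes `z ↦ S z u₀` measurable into `B`. It is therefore
replaced by its values on the lattice `δ ℤ²`, corrected by a phase. This gives a genuine integral in
`B`, bounded by the norm of `f`. Shifts act strongly continuously on the modulation space that
contains `f₀` (`tendsto_lintegral_stft_sub`), so for small `δ` the error has at most half the norm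
of `f` (`stftNorm_sub_le`, `exists_approx`). Iterating on the error yields a convergent series in
`B` whose sum is mapped by `ι` to `f` (`exists_preimage_of_approx`).

These estimates need a measurable submultiplicative weight that controls `‖S z‖`. The local supremum
`localSup S` is one, and a constant multiple of `v`, in the coordinates `(x, ξ)`, dominates it. -/

theorem seminorm_succ_right (k l : ℕ) (φ : 𝓢(ℝ, ℂ)) :
    SchwartzMap.seminorm ℂ k (l + 1) φ = SchwartzMap.seminorm ℂ k l (derivCLM ℂ ℂ φ) := by
  have h : ∀ t, iteratedDeriv (l + 1) φ t = iteratedDeriv l (derivCLM ℂ ℂ φ) t := fun t ↦ by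
    rw [iteratedDeriv_succ']
    rfl
  apply le_antisymm
  · refine seminorm_le_bound' ℂ _ _ _ (apply_nonneg _ _) fun t ↦ ?_
    rw [h]
    exact le_seminorm' ℂ k l _ t
  · refine seminorm_le_bound' ℂ _ _ _ (apply_nonneg _ _) fun t ↦ ?_
    rw [← h]
    exact le_seminorm' ℂ k (l + 1) _ t

/-- Multiplication by the coordinate function. -/
noncomputable def mulCoord : 𝓢(ℝ, ℂ) →L[ℂ] 𝓢(ℝ, ℂ) :=
  smulLeftCLM ℂ (fun t : ℝ ↦ (t : ℂ))

theorem mulCoord_apply (φ : 𝓢(ℝ, ℂ)) (t : ℝ) : mulCoord φ t = t * φ t := by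
  rw [mulCoord, smulLeftCLM_apply_apply, smul_eq_mul]
  exact Complex.ofRealCLM.hasTemperateGrowth

theorem mulCoord_pow_apply (k : ℕ) (φ : 𝓢(ℝ, ℂ)) (t : ℝ) :
    (mulCoord ^ k) φ t = (t : ℂ) ^ k * φ t := by
  induction k with
  | zero => simp
  | succ k ih => rw [pow_succ', mul_apply_eq_comp, mulCoord_apply, ih]; ring

theorem derivCLM_pow_apply (l : ℕ) (φ : 𝓢(ℝ, ℂ)) (t : ℝ) :
    ((derivCLM ℂ ℂ) ^ l) φ t = iteratedDeriv l φ t := by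
  induction l generalizing φ with
  | zero => simp
  | succ l ih =>
    rw [pow_succ, mul_apply_eq_comp, ih, iteratedDeriv_succ']
    rfl

/-- The embedding of the Schwartz space into a finite product of spaces of bounded continuous
functions, by the functions `t ^ k φ⁽ˡ⁾(t)` with `(k, l) ∈ s`. -/
noncomputable def toBoundedPi (s : Finset (ℕ × ℕ)) :
    𝓢(ℝ, ℂ) →L[ℂ] (s → BoundedContinuousFunction ℝ ℂ) :=
  ContinuousLinearMap.pi fun i ↦ (toBoundedContinuousFunctionCLM ℂ ℝ ℂ).comp
    ((mulCoord ^ i.1.1).comp ((derivCLM ℂ ℂ) ^ i.1.2))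

theorem toBoundedPi_apply (s : Finset (ℕ × ℕ)) (φ : 𝓢(ℝ, ℂ)) (i : s) (t : ℝ) :
    toBoundedPi s φ i t = (t : ℂ) ^ i.1.1 * iteratedDeriv i.1.2 φ t := by
  rw [← derivCLM_pow_apply, ← mulCoord_pow_apply]
  rfl

theorem sup_seminorm_le_norm_toBoundedPi (s : Finset (ℕ × ℕ)) (φ : 𝓢(ℝ, ℂ)) :
    s.sup (schwartzSeminormFamily ℂ ℝ ℂ) φ ≤ ‖toBoundedPi s φ‖ := by
  refine Seminorm.finset_sup_apply_le (norm_nonneg _) fun i hi ↦ ?_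
  refine seminorm_le_bound' ℂ _ _ _ (norm_nonneg _) fun t ↦ ?_
  have h1 := (BoundedContinuousFunction.norm_coe_le_norm (toBoundedPi s φ ⟨i, hi⟩) t).trans
    (norm_le_pi_norm (toBoundedPi s φ) ⟨i, hi⟩)
  rw [toBoundedPi_apply, norm_mul, norm_pow, Complex.norm_real, Real.norm_eq_abs] at h1
  exact h1

theorem norm_toBoundedPi_le (s : Finset (ℕ × ℕ)) (φ : 𝓢(ℝ, ℂ)) :
    ‖toBoundedPi s φ‖ ≤ ∑ i ∈ s, SchwartzMap.seminorm ℂ i.1 i.2 φ := by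
  have h0 : 0 ≤ ∑ i ∈ s, SchwartzMap.seminorm ℂ i.1 i.2 φ :=
    Finset.sum_nonneg fun i _ ↦ apply_nonneg _ _
  refine (pi_norm_le_iff_of_nonneg h0).2 fun i ↦ (BoundedContinuousFunction.norm_le h0).2 fun t ↦ ?_
  rw [toBoundedPi_apply, norm_mul, norm_pow, Complex.norm_real, Real.norm_eq_abs]
  exact (le_seminorm' ℂ _ _ φ t).trans (Finset.single_le_sum
    (f := fun i : ℕ × ℕ ↦ SchwartzMap.seminorm ℂ i.1 i.2 φ) (fun i _ ↦ apply_nonneg _ _) i.2)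

/-- A tempered distribution extends to a bounded functional on a finite product of spaces of
bounded continuous functions. -/
theorem exists_extension_toBoundedPi (f : 𝓢'(ℝ, ℂ)) :
    ∃ (s : Finset (ℕ × ℕ)) (L : (s → BoundedContinuousFunction ℝ ℂ) →L[ℂ] ℂ),
      ∀ φ, f φ = L (toBoundedPi s φ) := by
  have hf : Continuous fun φ : 𝓢(ℝ, ℂ) ↦ f φ := map_continuous f
  obtain ⟨s, C, -, hC⟩ := Seminorm.bound_of_continuous (schwartz_withSeminorms ℂ ℝ ℂ)
    ((normSeminorm ℂ ℂ).comp (f : 𝓢(ℝ, ℂ) →ₗ[ℂ] ℂ)) hf.norm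
  have hb : ∀ φ, ‖f φ‖ ≤ C * ‖toBoundedPi s φ‖ := fun φ ↦
    (hC φ).trans (mul_le_mul_of_nonneg_left (sup_seminorm_le_norm_toBoundedPi s φ) C.2)
  let J : 𝓢(ℝ, ℂ) →ₗ[ℂ] (s → BoundedContinuousFunction ℝ ℂ) := toBoundedPi s
  -- The bound makes `f` constant on the fibres of `J`, so `f` descends to a bounded functional on
  -- the range, to which Hahn-Banach applies.
  have hker : ∀ φ ψ, J φ = J ψ → f φ = f ψ := fun φ ψ h ↦ by
    have h1 := hb (φ - ψ)
    have h2 : toBoundedPi s (φ - ψ) = 0 := by rw [map_sub]; exact sub_eq_zero.2 h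
    rw [h2, norm_zero, mul_zero, map_sub] at h1
    exact sub_eq_zero.1 (norm_le_zero_iff.1 h1)
  choose σ hσ using fun y : LinearMap.range J ↦ y.2
  let L₀ : LinearMap.range J →ₗ[ℂ] ℂ :=
    { toFun := fun y ↦ f (σ y)
      map_add' := fun y z ↦ by
        rw [← map_add]
        exact hker _ _ (by rw [map_add, hσ, hσ, hσ]; rfl)
      map_smul' := fun c y ↦ by
        rw [RingHom.id_apply, ← map_smul]
        exact hker _ _ (by rw [map_smul, hσ, hσ]; rfl) }
  let L₁ : LinearMap.range J →L[ℂ] ℂ := L₀.mkContinuous C fun y ↦ by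
    refine (hb (σ y)).trans_eq ?_
    congr 2
    exact hσ y
  obtain ⟨L, hL, -⟩ := exists_extension_norm_eq _ L₁
  refine ⟨s, L, fun φ ↦ ?_⟩
  have := hL ⟨J φ, LinearMap.mem_range_self J φ⟩
  exact (hker _ _ (hσ ⟨J φ, LinearMap.mem_range_self J φ⟩)).symm.trans this.symm

theorem continuous_apply_of_continuous {Z : Type*} [TopologicalSpace Z] {E : Z → 𝓢(ℝ, ℂ)}
    (hE : Continuous E) (t : ℝ) : Continuous fun z ↦ E z t :=
  (map_continuous (TemperedDistribution.delta t)).comp hE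

section Integral

variable {Z : Type*} [TopologicalSpace Z] [MeasurableSpace Z] [OpensMeasurableSpace Z]
  {μ : Measure Z}

theorem integrable_apply {E : Z → 𝓢(ℝ, ℂ)} (hE : Continuous E)
    (hint : ∀ k l, Integrable (fun z ↦ SchwartzMap.seminorm ℂ k l (E z)) μ) (t : ℝ) :
    Integrable (fun z ↦ E z t) μ :=
  (hint 0 0).mono' (continuous_apply_of_continuous hE t).aestronglyMeasurable
    (ae_of_all _ fun z ↦ norm_le_seminorm ℂ (E z) t)

/-- Differentiation under the integral sign: the seminorm with indices `(0, 1)` dominates the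
derivative uniformly in `t`. The induction passes from `E` to its derivative, which satisfies the
same hypotheses. -/
theorem integral_iteratedDeriv_apply {E : Z → 𝓢(ℝ, ℂ)} (hE : Continuous E)
    (hint : ∀ k l, Integrable (fun z ↦ SchwartzMap.seminorm ℂ k l (E z)) μ) {φ : 𝓢(ℝ, ℂ)}
    (hφ : ∀ t, ∫ z, E z t ∂μ = φ t) (l : ℕ) (t : ℝ) :
    ∫ z, iteratedDeriv l (E z) t ∂μ = iteratedDeriv l φ t := by
  induction l generalizing E φ t with
  | zero => simpa using hφ t
  | succ l ih =>
    have hD : Continuous fun z ↦ derivCLM ℂ ℂ (E z) := (derivCLM ℂ ℂ).continuous.comp hE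
    have hD' : ∀ k l, Integrable
        (fun z ↦ SchwartzMap.seminorm ℂ k l (derivCLM ℂ ℂ (E z))) μ := fun k l ↦ by
      simpa only [← seminorm_succ_right] using hint k (l + 1)
    have key : ∀ t, ∫ z, derivCLM ℂ ℂ (E z) t ∂μ = derivCLM ℂ ℂ φ t := fun t ↦ by
      have h := (hasDerivAt_integral_of_dominated_loc_of_deriv_le (μ := μ) (F := fun t z ↦ E z t)
        (F' := fun t z ↦ derivCLM ℂ ℂ (E z) t) (x₀ := t) (s := Set.univ)
        (bound := fun z ↦ SchwartzMap.seminorm ℂ 0 1 (E z)) Filter.univ_mem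
        (Eventually.of_forall fun t ↦ (continuous_apply_of_continuous hE t).aestronglyMeasurable)
        (integrable_apply hE hint t) (continuous_apply_of_continuous hD t).aestronglyMeasurable
        (ae_of_all _ fun z s _ ↦ by
          rw [seminorm_succ_right]; exact norm_le_seminorm ℂ _ s)
        (hint 0 1) (ae_of_all _ fun z s _ ↦ (E z).hasDerivAt s)).2
      simp only [hφ] at h
      exact h.unique (φ.hasDerivAt t)
    have := ih hD hD' key t
    simp only [iteratedDeriv_succ']
    exact this

variable [SecondCountableTopology Z]

theorem integrable_toBoundedPi {E : Z → 𝓢(ℝ, ℂ)} (hE : Continuous E)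
    (hint : ∀ k l, Integrable (fun z ↦ SchwartzMap.seminorm ℂ k l (E z)) μ)
    (s : Finset (ℕ × ℕ)) : Integrable (fun z ↦ toBoundedPi s (E z)) μ :=
  -- Bounded continuous functions form a non-separable space, so strong measurability has to come
  -- from second countability of `Z`.
  haveI := secondCountableTopologyEither_of_left Z (s → BoundedContinuousFunction ℝ ℂ)
  (integrable_finsetSum s fun i _ ↦ hint i.1 i.2).mono'
    ((toBoundedPi s).continuous.comp hE).aestronglyMeasurable
    (ae_of_all _ fun z ↦ norm_toBoundedPi_le s (E z))

/-- A tempered distribution commutes with absolutely convergent integrals of Schwartz functions. -/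
theorem integral_pairing_eq {E : Z → 𝓢(ℝ, ℂ)} (hE : Continuous E)
    (hint : ∀ k l, Integrable (fun z ↦ SchwartzMap.seminorm ℂ k l (E z)) μ) {φ : 𝓢(ℝ, ℂ)}
    (hφ : ∀ t, ∫ z, E z t ∂μ = φ t) (f : 𝓢'(ℝ, ℂ)) :
    ∫ z, f (E z) ∂μ = f φ := by
  obtain ⟨s, L, hL⟩ := exists_extension_toBoundedPi f
  have hJ := integrable_toBoundedPi hE hint s
  simp only [hL]
  rw [L.integral_comp_comm hJ]
  congr 1
  -- Point evaluations of the components are continuous functionals that separate points, so they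
  -- identify the Bochner integral.
  funext i
  ext t
  have h1 := (((BoundedContinuousFunction.evalCLM ℂ t).comp (ContinuousLinearMap.proj (R := ℂ)
    (φ := fun _ : s ↦ BoundedContinuousFunction ℝ ℂ) i))).integral_comp_comm hJ
  refine h1.symm.trans ?_
  have h2 : ∀ ψ : 𝓢(ℝ, ℂ), ((BoundedContinuousFunction.evalCLM ℂ t).comp
      (ContinuousLinearMap.proj (R := ℂ) (φ := fun _ : s ↦ BoundedContinuousFunction ℝ ℂ) i))
      (toBoundedPi s ψ) = (t : ℂ) ^ i.1.1 * iteratedDeriv i.1.2 ψ t :=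
    fun ψ ↦ toBoundedPi_apply s ψ i t
  simp only [h2]
  rw [integral_const_mul, integral_iteratedDeriv_apply hE hint hφ, toBoundedPi_apply]

end Integral

end SchwartzMap

/-! ### Time-frequency shifts on the Schwartz space. -/

namespace SAFT

/-- The character `s ↦ exp (2 π i s)`. -/
noncomputable def ex (s : ℝ) : ℂ := Complex.exp ((2 * Real.pi * s : ℝ) * Complex.I)

@[simp] theorem norm_ex (s : ℝ) : ‖ex s‖ = 1 := Complex.norm_exp_ofReal_mul_I _

@[simp] theorem ex_zero : ex 0 = 1 := by simp [ex]

theorem ex_add (s t : ℝ) : ex (s + t) = ex s * ex t := by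
  simp only [ex, ← Complex.exp_add]
  congr 1
  push_cast
  ring

theorem ex_mul_ex_neg (s : ℝ) : ex s * ex (-s) = 1 := by
  rw [← ex_add, add_neg_cancel, ex_zero]

theorem continuous_ex : Continuous ex := by
  unfold ex
  fun_prop

theorem hasDerivAt_ex_mul (ξ t : ℝ) :
    HasDerivAt (fun t : ℝ ↦ ex (ξ * t)) ((2 * Real.pi * ξ : ℝ) * Complex.I * ex (ξ * t)) t := by
  have h1 : HasDerivAt (fun t : ℝ ↦ (2 * Real.pi * (ξ * t) : ℝ)) (2 * Real.pi * ξ) t := by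
    simpa [mul_assoc] using (hasDerivAt_id t).const_mul (2 * Real.pi * ξ)
  have h2 := (h1.ofReal_comp.mul_const Complex.I).cexp
  exact h2.congr_deriv (mul_comm _ _)

theorem norm_ex_sub_ex_le (s t : ℝ) : ‖ex s - ex t‖ ≤ 2 * Real.pi * |s - t| := by
  have h : ex s - ex t = ex t * (Complex.exp (Complex.I * (2 * Real.pi * (s - t) : ℝ)) - 1) := by
    have : Complex.exp (Complex.I * (2 * Real.pi * (s - t) : ℝ)) = ex (s - t) := by
      rw [ex, mul_comm]
    rw [this, mul_sub, ← ex_add, mul_one, add_sub_cancel]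
  rw [h, norm_mul, norm_ex, one_mul]
  refine Real.norm_exp_I_mul_ofReal_sub_one_le.trans_eq ?_
  rw [Real.norm_eq_abs, abs_mul, abs_of_pos Real.two_pi_pos]

/-- The time-frequency shift `φ ↦ exp (2 π i ξ t) φ (t - x)`, where `z = (x, ξ)`. -/
noncomputable def tfShift (z : ℝ × ℝ) : 𝓢(ℝ, ℂ) →L[ℂ] 𝓢(ℝ, ℂ) :=
  (mulPhase 0 (2 * Real.pi * z.2) 0).comp (SchwartzMap.compSubConstCLM ℂ z.1)

theorem tfShift_apply (z : ℝ × ℝ) (φ : 𝓢(ℝ, ℂ)) (t : ℝ) :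
    tfShift z φ t = ex (z.2 * t) * φ (t - z.1) := by
  simp only [tfShift, ContinuousLinearMap.comp_apply, SchwartzMap.compSubConstCLM_apply,
    mulPhase_apply, phase, ex]
  congr 4
  ring

/-- The inverse of `tfShift z`. -/
noncomputable def tfShiftInv (z : ℝ × ℝ) : 𝓢(ℝ, ℂ) →L[ℂ] 𝓢(ℝ, ℂ) :=
  (SchwartzMap.compSubConstCLM ℂ (-z.1)).comp (mulPhase 0 (2 * Real.pi * -z.2) 0)

theorem tfShiftInv_apply (z : ℝ × ℝ) (φ : 𝓢(ℝ, ℂ)) (t : ℝ) :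
    tfShiftInv z φ t = ex (-z.2 * (t + z.1)) * φ (t + z.1) := by
  simp only [tfShiftInv, ContinuousLinearMap.comp_apply, SchwartzMap.compSubConstCLM_apply,
    mulPhase_apply, phase, ex, sub_neg_eq_add]
  congr 4
  ring

theorem tfShiftInv_eq_smul (z : ℝ × ℝ) (φ : 𝓢(ℝ, ℂ)) :
    tfShiftInv z φ = ex (-z.2 * z.1) • tfShift (-z) φ := by
  ext t
  rw [smul_apply, smul_eq_mul, tfShiftInv_apply, tfShift_apply, ← mul_assoc, ← ex_add,
    Prod.fst_neg, Prod.snd_neg, sub_neg_eq_add]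
  ring_nf

theorem tfShiftInv_zero (φ : 𝓢(ℝ, ℂ)) : tfShiftInv 0 φ = φ := by
  ext t
  simp [tfShiftInv_apply]

/-- Shifts compose only up to a phase. Norm estimates ignore it, but the lattice discretization must
compensate for it. -/
theorem tfShiftInv_tfShift (z w : ℝ × ℝ) (φ : 𝓢(ℝ, ℂ)) :
    tfShiftInv z (tfShift w φ) = ex (z.1 * (w.2 - z.2)) • tfShift (w - z) φ := by
  ext t
  rw [smul_apply, smul_eq_mul, tfShiftInv_apply, tfShift_apply, tfShift_apply,
    ← mul_assoc, ← ex_add, ← mul_assoc, ← ex_add, Prod.fst_sub, Prod.snd_sub]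
  ring_nf

theorem tfShiftInv_tfShiftInv (z w : ℝ × ℝ) (φ : 𝓢(ℝ, ℂ)) :
    tfShiftInv w (tfShiftInv z φ) = ex (w.2 * z.1) • tfShiftInv (z + w) φ := by
  ext t
  rw [smul_apply, smul_eq_mul, tfShiftInv_apply, tfShiftInv_apply, tfShiftInv_apply,
    ← mul_assoc, ← ex_add, ← mul_assoc, ← ex_add, Prod.fst_add, Prod.snd_add]
  ring_nf

theorem derivCLM_tfShift (z : ℝ × ℝ) (φ : 𝓢(ℝ, ℂ)) :
    SchwartzMap.derivCLM ℂ ℂ (tfShift z φ) =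
      ((2 * Real.pi * z.2 : ℝ) * Complex.I : ℂ) • tfShift z φ +
        tfShift z (SchwartzMap.derivCLM ℂ ℂ φ) := by
  ext t
  rw [add_apply, smul_apply, smul_eq_mul, SchwartzMap.derivCLM_apply,
    tfShift_apply, tfShift_apply, SchwartzMap.derivCLM_apply]
  have h : HasDerivAt (fun t ↦ ex (z.2 * t) * φ (t - z.1)) _ t :=
    (hasDerivAt_ex_mul z.2 t).mul ((φ.hasDerivAt (t - z.1)).comp_sub_const t z.1)
  rw [show (tfShift z φ : ℝ → ℂ) = fun t ↦ ex (z.2 * t) * φ (t - z.1) from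
    funext fun t ↦ tfShift_apply z φ t, h.deriv]
  ring

theorem abs_pow_le_mul_pow (x t : ℝ) (k : ℕ) :
    |t| ^ k ≤ (1 + |x|) ^ k * (1 + |t - x|) ^ k := by
  rw [← mul_pow]
  refine pow_le_pow_left₀ (abs_nonneg t) ?_ k
  have h : |t| ≤ |t - x| + |x| := by simpa using abs_add_le (t - x) x
  nlinarith [abs_nonneg x, abs_nonneg (t - x)]

theorem exists_one_add_abs_pow_mul_le (φ : 𝓢(ℝ, ℂ)) (k : ℕ) :
    ∃ C, 0 ≤ C ∧ ∀ t, (1 + |t|) ^ k * ‖φ t‖ ≤ C := by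
  refine ⟨2 ^ k * (Finset.Iic (k, 0)).sup (fun m ↦ SchwartzMap.seminorm ℂ m.1 m.2) φ,
    mul_nonneg (by positivity) (apply_nonneg _ _), fun t ↦ ?_⟩
  simpa using SchwartzMap.one_add_le_sup_seminorm_apply (𝕜 := ℂ) (m := (k, 0)) le_rfl le_rfl φ t

/-- The Schwartz seminorms of `tfShift z φ` grow at most polynomially in `z`. -/
theorem exists_seminorm_tfShift_le (k l : ℕ) (φ : 𝓢(ℝ, ℂ)) :
    ∃ C, 0 ≤ C ∧ ∀ z, SchwartzMap.seminorm ℂ k l (tfShift z φ) ≤ C * (1 + ‖z‖) ^ (k + l) := by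
  induction l generalizing φ with
  | zero =>
    obtain ⟨C, hC, h⟩ := exists_one_add_abs_pow_mul_le φ k
    refine ⟨C, hC, fun z ↦ SchwartzMap.seminorm_le_bound' ℂ _ _ _ (by positivity) fun t ↦ ?_⟩
    rw [iteratedDeriv_zero, tfShift_apply, norm_mul, norm_ex, one_mul]
    have h1 : |z.1| ≤ ‖z‖ := norm_fst_le z
    calc |t| ^ k * ‖φ (t - z.1)‖
        ≤ ((1 + |z.1|) ^ k * (1 + |t - z.1|) ^ k) * ‖φ (t - z.1)‖ := by
          gcongr
          exact abs_pow_le_mul_pow z.1 t k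
      _ = (1 + |z.1|) ^ k * ((1 + |t - z.1|) ^ k * ‖φ (t - z.1)‖) := by ring
      _ ≤ (1 + ‖z‖) ^ k * C := by
          gcongr
          exact h _
      _ = C * (1 + ‖z‖) ^ (k + 0) := by ring
  | succ l ih =>
    obtain ⟨C, hC, h⟩ := ih φ
    obtain ⟨D, hD, h'⟩ := ih (SchwartzMap.derivCLM ℂ ℂ φ)
    refine ⟨2 * Real.pi * C + D, by positivity, fun z ↦ ?_⟩
    have h2 : |z.2| ≤ ‖z‖ := norm_snd_le z
    rw [SchwartzMap.seminorm_succ_right, derivCLM_tfShift]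
    calc _ ≤ 2 * Real.pi * |z.2| * SchwartzMap.seminorm ℂ k l (tfShift z φ) +
          SchwartzMap.seminorm ℂ k l (tfShift z (SchwartzMap.derivCLM ℂ ℂ φ)) := by
          refine (map_add_le_add _ _ _).trans_eq ?_
          rw [map_smul_eq_mul, norm_mul, Complex.norm_I, mul_one, Complex.norm_real,
            Real.norm_eq_abs, abs_mul, abs_of_pos Real.two_pi_pos]
      _ ≤ 2 * Real.pi * (1 + ‖z‖) * (C * (1 + ‖z‖) ^ (k + l)) +
          D * (1 + ‖z‖) ^ (k + l) * (1 + ‖z‖) := by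
          gcongr
          · linarith
          · exact h z
          · exact (h' z).trans (le_mul_of_one_le_right (by positivity)
              (by linarith [norm_nonneg z]))
      _ = _ := by ring

/-- Mean value inequality for `s ↦ |t| ^ k φ (t - s)` between `y` and `x`. There `|s| ≤ 1 + |y|`,
which gives the factor `2 + |y|`. -/
theorem norm_apply_sub_sub_apply_sub_le (φ : 𝓢(ℝ, ℂ)) (k : ℕ) :
    ∃ C, 0 ≤ C ∧ ∀ x y t, |x - y| ≤ 1 →
      |t| ^ k * ‖φ (t - x) - φ (t - y)‖ ≤ C * (2 + |y|) ^ k * |x - y| := by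
  obtain ⟨C, hC, h⟩ := exists_one_add_abs_pow_mul_le (SchwartzMap.derivCLM ℂ ℂ φ) k
  refine ⟨C, hC, fun x y t hxy ↦ ?_⟩
  have hd : ∀ s, HasDerivAt (fun s ↦ φ (t - s)) (-deriv φ (t - s)) s := fun s ↦ by
    have := (φ.hasDerivAt (t - s)).scomp s ((hasDerivAt_id s).const_sub t)
    rw [neg_one_smul] at this
    exact this
  have key : ∀ s ∈ Set.uIcc y x, ‖(|t| ^ k : ℝ) • (-deriv φ (t - s))‖ ≤ C * (2 + |y|) ^ k := by
    intro s hs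
    have h1 : |s| ≤ 1 + |y| := by
      have := Set.abs_sub_left_of_mem_uIcc hs
      have h3 : |s| ≤ |s - y| + |y| := by simpa using abs_add_le (s - y) y
      linarith
    rw [norm_smul, norm_neg, norm_pow, norm_abs_eq_norm, Real.norm_eq_abs]
    calc |t| ^ k * ‖deriv φ (t - s)‖
        ≤ ((1 + |s|) ^ k * (1 + |t - s|) ^ k) * ‖deriv φ (t - s)‖ := by
          gcongr
          exact abs_pow_le_mul_pow s t k
      _ = (1 + |s|) ^ k * ((1 + |t - s|) ^ k * ‖deriv φ (t - s)‖) := by ring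
      _ ≤ (2 + |y|) ^ k * C := by
          refine mul_le_mul (pow_le_pow_left₀ (by positivity) (by linarith) k) (h _)
            (by positivity) (by positivity)
      _ = _ := by ring
  have := (convex_uIcc y x).norm_image_sub_le_of_norm_hasDerivWithin_le
    (f := fun s ↦ (|t| ^ k : ℝ) • φ (t - s))
    (fun s _ ↦ ((hd s).const_smul (|t| ^ k : ℝ)).hasDerivWithinAt) key
    Set.left_mem_uIcc Set.right_mem_uIcc
  rw [← smul_sub, norm_smul, norm_pow, norm_abs_eq_norm, Real.norm_eq_abs, Real.norm_eq_abs] at this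
  exact this

theorem tendsto_seminorm_tfShift_sub (k l : ℕ) (φ : 𝓢(ℝ, ℂ)) (w : ℝ × ℝ) :
    Tendsto (fun z ↦ SchwartzMap.seminorm ℂ k l (tfShift z φ - tfShift w φ)) (𝓝 w) (𝓝 0) := by
  induction l generalizing φ with
  | zero =>
    obtain ⟨C, hC, h⟩ := norm_apply_sub_sub_apply_sub_le φ k
    -- The extra power of `t` pays for the factor `|t|` in the Lipschitz bound of `ex (z.2 * t) - ex
    -- (w.2 * t)`.
    obtain ⟨D, hD, h'⟩ := exists_seminorm_tfShift_le (k + 1) 0 φ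
    have hlim : Tendsto (fun z : ℝ × ℝ ↦ C * (2 + |w.1|) ^ k * |z.1 - w.1| +
        2 * Real.pi * |z.2 - w.2| * (D * (1 + ‖w‖) ^ (k + 1 + 0))) (𝓝 w) (𝓝 0) := by
      have : Continuous (fun z : ℝ × ℝ ↦ C * (2 + |w.1|) ^ k * |z.1 - w.1| +
        2 * Real.pi * |z.2 - w.2| * (D * (1 + ‖w‖) ^ (k + 1 + 0))) := by fun_prop
      simpa using this.tendsto w
    refine squeeze_zero' (Eventually.of_forall fun z ↦ apply_nonneg _ _) ?_ hlim
    have hnear : ∀ᶠ z : ℝ × ℝ in 𝓝 w, |z.1 - w.1| ≤ 1 := by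
      have : Continuous fun z : ℝ × ℝ ↦ |z.1 - w.1| := by fun_prop
      exact (this.tendsto w).eventually (ge_mem_nhds (by simp))
    filter_upwards [hnear] with z hz
    refine SchwartzMap.seminorm_le_bound' ℂ _ _ _ (by positivity) fun t ↦ ?_
    rw [iteratedDeriv_zero, sub_apply, tfShift_apply, tfShift_apply]
    have e1 : ex (z.2 * t) * φ (t - z.1) - ex (w.2 * t) * φ (t - w.1) =
        ex (z.2 * t) * (φ (t - z.1) - φ (t - w.1)) +
          (ex (z.2 * t) - ex (w.2 * t)) * φ (t - w.1) := by ring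
    have e2 : |t| ^ (k + 1) * ‖φ (t - w.1)‖ ≤ D * (1 + ‖w‖) ^ (k + 1 + 0) := by
      have := (SchwartzMap.le_seminorm' ℂ (k + 1) 0 (tfShift w φ) t).trans (h' w)
      rwa [iteratedDeriv_zero, tfShift_apply, norm_mul, norm_ex, one_mul] at this
    have e3 : ‖ex (z.2 * t) - ex (w.2 * t)‖ ≤ 2 * Real.pi * (|z.2 - w.2| * |t|) := by
      refine (norm_ex_sub_ex_le _ _).trans_eq ?_
      rw [← sub_mul, abs_mul]
    calc _ ≤ |t| ^ k * (‖φ (t - z.1) - φ (t - w.1)‖ +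
          2 * Real.pi * (|z.2 - w.2| * |t|) * ‖φ (t - w.1)‖) := by
          rw [e1]
          gcongr
          refine (norm_add_le _ _).trans ?_
          rw [norm_mul, norm_mul, norm_ex, one_mul]
          gcongr
      _ = |t| ^ k * ‖φ (t - z.1) - φ (t - w.1)‖ +
          2 * Real.pi * |z.2 - w.2| * (|t| ^ (k + 1) * ‖φ (t - w.1)‖) := by ring
      _ ≤ _ := add_le_add (h _ _ t hz) (by gcongr)
  | succ l ih =>
    have h2 := ih (SchwartzMap.derivCLM ℂ ℂ φ)
    have h1 := ih φ
    have hlim : Tendsto (fun z : ℝ × ℝ ↦ 2 * Real.pi * |z.2| *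
        SchwartzMap.seminorm ℂ k l (tfShift z φ - tfShift w φ) +
        2 * Real.pi * |z.2 - w.2| * SchwartzMap.seminorm ℂ k l (tfShift w φ) +
        SchwartzMap.seminorm ℂ k l (tfShift z (SchwartzMap.derivCLM ℂ ℂ φ) -
          tfShift w (SchwartzMap.derivCLM ℂ ℂ φ))) (𝓝 w) (𝓝 0) := by
      have c1 : Continuous fun z : ℝ × ℝ ↦ 2 * Real.pi * |z.2| := by fun_prop
      have c2 : Continuous fun z : ℝ × ℝ ↦ 2 * Real.pi * |z.2 - w.2| *
        SchwartzMap.seminorm ℂ k l (tfShift w φ) := by fun_prop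
      simpa using (((c1.tendsto w).mul h1).add (c2.tendsto w)).add h2
    refine squeeze_zero (fun z ↦ apply_nonneg _ _) (fun z ↦ ?_) hlim
    have e : SchwartzMap.derivCLM ℂ ℂ (tfShift z φ - tfShift w φ) =
        ((2 * Real.pi * z.2 : ℝ) * Complex.I : ℂ) • (tfShift z φ - tfShift w φ) +
        ((2 * Real.pi * (z.2 - w.2) : ℝ) * Complex.I : ℂ) • tfShift w φ +
        (tfShift z (SchwartzMap.derivCLM ℂ ℂ φ) - tfShift w (SchwartzMap.derivCLM ℂ ℂ φ)) := by
      rw [map_sub, derivCLM_tfShift, derivCLM_tfShift]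
      push_cast
      module
    have n : ∀ s : ℝ, ‖((2 * Real.pi * s : ℝ) * Complex.I : ℂ)‖ = 2 * Real.pi * |s| := fun s ↦ by
      rw [norm_mul, Complex.norm_I, mul_one, Complex.norm_real,
            Real.norm_eq_abs, abs_mul, abs_of_pos Real.two_pi_pos]
    rw [SchwartzMap.seminorm_succ_right, e]
    refine (map_add_le_add _ _ _).trans (add_le_add_left ((map_add_le_add _ _ _).trans_eq ?_) _)
    rw [map_smul_eq_mul, map_smul_eq_mul, n, n]

/-- Time-frequency shifts act strongly continuously on the Schwartz space. -/
theorem continuous_tfShift (φ : 𝓢(ℝ, ℂ)) : Continuous fun z ↦ tfShift z φ := by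
  refine continuous_iff_continuousAt.2 fun w ↦ ?_
  exact ((schwartz_withSeminorms ℂ ℝ ℂ).tendsto_nhds _ _).2 fun i ε hε ↦
    (tendsto_seminorm_tfShift_sub i.1 i.2 φ w).eventually (gt_mem_nhds hε)

theorem continuous_tfShiftInv (φ : 𝓢(ℝ, ℂ)) : Continuous fun z ↦ tfShiftInv z φ := by
  simp only [tfShiftInv_eq_smul]
  refine Continuous.smul (continuous_ex.comp (by fun_prop)) ?_
  exact (continuous_tfShift φ).comp continuous_neg

/-! ### Ambiguity functions and the orthogonality relation. -/

open SchwartzMap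

theorem integrable_mul (γ φ : 𝓢(ℝ, ℂ)) : Integrable fun t ↦ γ t * φ t :=
  (pairing (ContinuousLinearMap.mul ℂ ℂ) γ φ).integrable

/-- The bilinear cross-ambiguity function `z ↦ ∫ γ (tfShiftInv z φ)`. -/
noncomputable def ambiguity (γ φ : 𝓢(ℝ, ℂ)) (z : ℝ × ℝ) : ℂ := ∫ t, γ t * tfShiftInv z φ t

theorem continuous_ambiguity (γ φ : 𝓢(ℝ, ℂ)) : Continuous (ambiguity γ φ) := by
  have h := (map_continuous (γ : 𝓢'(ℝ, ℂ))).comp (continuous_tfShiftInv φ)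
  refine h.congr fun z ↦ ?_
  rw [Function.comp_apply, coe_apply, ambiguity]
  simp only [smul_eq_mul, mul_comm]

theorem continuous_ambiguity_smul_tfShift (γ φ G : 𝓢(ℝ, ℂ)) :
    Continuous fun z ↦ ambiguity γ φ z • tfShift z G :=
  (continuous_ambiguity γ φ).smul (continuous_tfShift G)

/-- Write `z.1 = (t + z.1) - t` under the integral. Together with the integration by parts in
`snd_mul_ambiguity`, this trades polynomial factors in `z` for other Schwartz functions, whence
rapid decay. -/
theorem fst_mul_ambiguity (γ φ : 𝓢(ℝ, ℂ)) (z : ℝ × ℝ) :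
    z.1 * ambiguity γ φ z = ambiguity γ (mulCoord φ) z - ambiguity (mulCoord γ) φ z := by
  simp only [ambiguity]
  rw [← integral_sub (integrable_mul _ _) (integrable_mul _ _), ← integral_const_mul]
  congr 1
  funext t
  rw [tfShiftInv_apply, tfShiftInv_apply, mulCoord_apply, mulCoord_apply]
  push_cast
  ring

theorem derivCLM_tfShiftInv (z : ℝ × ℝ) (φ : 𝓢(ℝ, ℂ)) :
    derivCLM ℂ ℂ (tfShiftInv z φ) =
      tfShiftInv z (derivCLM ℂ ℂ φ) -
        ((2 * Real.pi * z.2 : ℝ) * Complex.I : ℂ) • tfShiftInv z φ := by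
  rw [tfShiftInv_eq_smul, tfShiftInv_eq_smul, map_smul, derivCLM_tfShift, Prod.snd_neg]
  push_cast
  module

theorem snd_mul_ambiguity (γ φ : 𝓢(ℝ, ℂ)) (z : ℝ × ℝ) :
    ((2 * Real.pi * z.2 : ℝ) * Complex.I : ℂ) * ambiguity γ φ z =
      ambiguity γ (derivCLM ℂ ℂ φ) z + ambiguity (derivCLM ℂ ℂ γ) φ z := by
  have h := integral_mul_deriv_eq_neg_deriv_mul γ (tfShiftInv z φ)
  have h1 : ∫ t, γ t * deriv (tfShiftInv z φ) t = ambiguity γ (derivCLM ℂ ℂ φ) z -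
      ((2 * Real.pi * z.2 : ℝ) * Complex.I : ℂ) * ambiguity γ φ z := by
    simp only [ambiguity]
    rw [← integral_const_mul, ← integral_sub (integrable_mul _ _)
      ((integrable_mul _ _).const_mul _)]
    congr 1
    funext t
    rw [← derivCLM_apply ℂ, derivCLM_tfShiftInv, sub_apply, smul_apply, smul_eq_mul]
    ring
  have h2 : ∫ t, deriv γ t * tfShiftInv z φ t = ambiguity (derivCLM ℂ ℂ γ) φ z := rfl
  rw [h1, h2] at h
  linear_combination -h

theorem exists_norm_ambiguity_le (γ φ : 𝓢(ℝ, ℂ)) :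
    ∃ C, 0 ≤ C ∧ ∀ z, ‖ambiguity γ φ z‖ ≤ C := by
  refine ⟨(∫ t, ‖γ t‖) * SchwartzMap.seminorm ℂ 0 0 φ, mul_nonneg (integral_nonneg fun _ ↦
    norm_nonneg _) (apply_nonneg _ _), fun z ↦ ?_⟩
  rw [← integral_mul_const]
  refine norm_integral_le_of_norm_le (γ.integrable.norm.mul_const _) (ae_of_all _ fun t ↦ ?_)
  rw [norm_mul, tfShiftInv_apply, norm_mul, norm_ex, one_mul]
  gcongr
  exact norm_le_seminorm ℂ φ _

theorem exists_pow_mul_norm_ambiguity_le (m n : ℕ) (γ φ : 𝓢(ℝ, ℂ)) :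
    ∃ C, 0 ≤ C ∧ ∀ z, |z.1| ^ m * |z.2| ^ n * ‖ambiguity γ φ z‖ ≤ C := by
  induction m generalizing γ φ with
  | zero =>
    induction n generalizing γ φ with
    | zero => simpa using exists_norm_ambiguity_le γ φ
    | succ n ih =>
      obtain ⟨C, hC, h⟩ := ih γ (derivCLM ℂ ℂ φ)
      obtain ⟨D, hD, h'⟩ := ih (derivCLM ℂ ℂ γ) φ
      refine ⟨C + D, by positivity, fun z ↦ ?_⟩
      have e := congrArg norm (snd_mul_ambiguity γ φ z)
      rw [norm_mul, norm_mul, Complex.norm_I, mul_one, Complex.norm_real, Real.norm_eq_abs, abs_mul,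
        abs_of_pos Real.two_pi_pos] at e
      have e1 : |z.2| * ‖ambiguity γ φ z‖ ≤ 2 * Real.pi * |z.2| * ‖ambiguity γ φ z‖ := by
        gcongr
        nlinarith [Real.pi_gt_three, abs_nonneg z.2]
      calc |z.1| ^ 0 * |z.2| ^ (n + 1) * ‖ambiguity γ φ z‖
          = |z.1| ^ 0 * |z.2| ^ n * (|z.2| * ‖ambiguity γ φ z‖) := by ring
        _ ≤ |z.1| ^ 0 * |z.2| ^ n * (‖ambiguity γ (derivCLM ℂ ℂ φ) z‖ +
            ‖ambiguity (derivCLM ℂ ℂ γ) φ z‖) := by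
          gcongr
          exact (e1.trans_eq e).trans (norm_add_le _ _)
        _ ≤ C + D := by
          rw [mul_add]
          exact add_le_add (h z) (h' z)
  | succ m ih =>
    obtain ⟨C, hC, h⟩ := ih γ (mulCoord φ)
    obtain ⟨D, hD, h'⟩ := ih (mulCoord γ) φ
    refine ⟨C + D, by positivity, fun z ↦ ?_⟩
    have e := congrArg norm (fst_mul_ambiguity γ φ z)
    rw [norm_mul, Complex.norm_real, Real.norm_eq_abs] at e
    calc |z.1| ^ (m + 1) * |z.2| ^ n * ‖ambiguity γ φ z‖
        = |z.1| ^ m * |z.2| ^ n * (|z.1| * ‖ambiguity γ φ z‖) := by ring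
      _ ≤ |z.1| ^ m * |z.2| ^ n * (‖ambiguity γ (mulCoord φ) z‖ +
            ‖ambiguity (mulCoord γ) φ z‖) := by
        gcongr
        exact e.trans_le (norm_sub_le _ _)
      _ ≤ C + D := by
        rw [mul_add]
        exact add_le_add (h z) (h' z)

/-- Ambiguity functions of Schwartz functions decay rapidly. -/
theorem exists_norm_ambiguity_le_div (N : ℕ) (γ φ : 𝓢(ℝ, ℂ)) :
    ∃ C, 0 ≤ C ∧ ∀ z, ‖ambiguity γ φ z‖ ≤ C / (1 + ‖z‖) ^ N := by
  obtain ⟨C₀, hC₀, h₀⟩ := exists_norm_ambiguity_le γ φ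
  obtain ⟨C₁, hC₁, h₁⟩ := exists_pow_mul_norm_ambiguity_le N 0 γ φ
  obtain ⟨C₂, hC₂, h₂⟩ := exists_pow_mul_norm_ambiguity_le 0 N γ φ
  refine ⟨2 ^ (N - 1) * (C₀ + (C₁ + C₂)), by positivity, fun z ↦ ?_⟩
  rw [le_div_iff₀ (by positivity)]
  have e1 : ‖z‖ ^ N ≤ |z.1| ^ N + |z.2| ^ N := by
    rw [Prod.norm_def, Real.norm_eq_abs, Real.norm_eq_abs]
    rcases max_choice |z.1| |z.2| with h | h <;> rw [h]
    · exact le_add_of_nonneg_right (by positivity)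
    · exact le_add_of_nonneg_left (by positivity)
  have e2 : (1 + ‖z‖) ^ N ≤ 2 ^ (N - 1) * (1 + (|z.1| ^ N + |z.2| ^ N)) := by
    refine (add_pow_le zero_le_one (norm_nonneg z) N).trans ?_
    rw [one_pow]
    gcongr
  have e3 := h₁ z
  have e4 := h₂ z
  simp only [pow_zero, mul_one, one_mul] at e3 e4
  calc ‖ambiguity γ φ z‖ * (1 + ‖z‖) ^ N
      ≤ ‖ambiguity γ φ z‖ * (2 ^ (N - 1) * (1 + (|z.1| ^ N + |z.2| ^ N))) := by gcongr
    _ = 2 ^ (N - 1) * (‖ambiguity γ φ z‖ + (|z.1| ^ N * ‖ambiguity γ φ z‖ +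
        |z.2| ^ N * ‖ambiguity γ φ z‖)) := by ring
    _ ≤ _ := by
      gcongr
      exact h₀ z

theorem integrable_inv_one_add_norm_pow_three :
    Integrable fun z : ℝ × ℝ ↦ ((1 + ‖z‖) ^ 3)⁻¹ := by
  have h := integrable_one_add_norm (E := ℝ × ℝ) (μ := volume) (r := 3) (by simp; norm_num)
  refine h.congr (ae_of_all _ fun z ↦ ?_)
  simp only
  rw [Real.rpow_neg (by positivity)]
  norm_cast

theorem integrable_seminorm_ambiguity_smul_tfShift (γ φ G : 𝓢(ℝ, ℂ)) (k l : ℕ) :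
    Integrable fun z ↦ SchwartzMap.seminorm ℂ k l (ambiguity γ φ z • tfShift z G) := by
  -- The power `k + l` absorbs the growth of the seminorm of the shift; the remaining `3` exceeds
  -- the dimension of the plane.
  obtain ⟨C, hC, h⟩ := exists_norm_ambiguity_le_div (k + l + 3) γ φ
  obtain ⟨D, hD, h'⟩ := exists_seminorm_tfShift_le k l G
  have hc : Continuous fun z ↦ SchwartzMap.seminorm ℂ k l (ambiguity γ φ z • tfShift z G) :=
    ((schwartz_withSeminorms ℂ ℝ ℂ).continuous_seminorm (k, l)).comp
      ((continuous_ambiguity γ φ).smul (continuous_tfShift G))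
  refine (integrable_inv_one_add_norm_pow_three.const_mul (C * D)).mono'
    hc.aestronglyMeasurable (ae_of_all _ fun z ↦ ?_)
  rw [Real.norm_of_nonneg (apply_nonneg _ _), map_smul_eq_mul]
  calc _ ≤ C / (1 + ‖z‖) ^ (k + l + 3) * (D * (1 + ‖z‖) ^ (k + l)) := by
        gcongr
        · exact h z
        · exact h' z
    _ = _ := by
        have : (1 + ‖z‖) ≠ 0 := by positivity
        rw [pow_add]
        field_simp

theorem ambiguity_eq_fourier (γ φ : 𝓢(ℝ, ℂ)) (x ξ : ℝ) :
    ambiguity γ φ (x, ξ) = FourierTransform.fourier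
      (pairing (ContinuousLinearMap.mul ℂ ℂ) (compSubConstCLM ℂ x γ) φ) ξ := by
  rw [fourier_coe, Real.fourier_real_eq, ambiguity, ← integral_sub_right_eq_self _ x]
  congr 1
  funext t
  rw [tfShiftInv_apply, pairing_apply_apply, compSubConstCLM_apply, sub_add_cancel, Circle.smul_def,
    Real.fourierChar_apply, ContinuousLinearMap.mul_apply', smul_eq_mul, ex]
  ring_nf

/-- Fourier inversion evaluates the integral over frequency as `γ (t - x) * φ t * G (t - x)`;
integrating over `x` leaves `∫ γ G` times `φ t`. -/
theorem integral_ambiguity_mul_tfShift_apply (γ φ G : 𝓢(ℝ, ℂ)) (t : ℝ) :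
    ∫ z, (ambiguity γ φ z • tfShift z G) t = ((∫ s, γ s * G s) • φ) t := by
  have hi := SchwartzMap.integrable_apply
    (continuous_ambiguity_smul_tfShift γ φ G)
    (integrable_seminorm_ambiguity_smul_tfShift γ φ G) t
  rw [Measure.volume_eq_prod] at hi ⊢
  rw [integral_prod _ hi]
  have h1 : ∀ x, ∫ ξ, (ambiguity γ φ (x, ξ) • tfShift (x, ξ) G) t =
      γ (t - x) * φ t * G (t - x) := fun x ↦ by
    set u := pairing (ContinuousLinearMap.mul ℂ ℂ) (compSubConstCLM ℂ x γ) φ with hu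
    have h2 : FourierTransformInv.fourierInv (FourierTransform.fourier u) t = u t := by
      rw [FourierTransform.fourierInv_fourier_eq]
    rw [fourierInv_coe, Real.fourierInv_eq'] at h2
    have h3 : u t = γ (t - x) * φ t := by
      rw [hu, pairing_apply_apply, compSubConstCLM_apply, ContinuousLinearMap.mul_apply']
    rw [← h3, ← h2, ← integral_mul_const]
    congr 1
    funext ξ
    rw [smul_apply, tfShift_apply, ambiguity_eq_fourier, ← hu, smul_eq_mul, smul_eq_mul, ex]
    simp only [RCLike.inner_apply, conj_trivial]
    ring_nf
  simp only [h1]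
  rw [smul_apply, smul_eq_mul, ← integral_mul_const, ← integral_sub_left_eq_self _ volume t]
  congr 1
  funext x
  rw [sub_sub_cancel]
  ring

/-- The orthogonality relation for short-time Fourier transforms, for a tempered distribution
and Schwartz functions. -/
theorem integral_ambiguity_mul_apply_tfShift (γ φ G : 𝓢(ℝ, ℂ)) (f : 𝓢'(ℝ, ℂ)) :
    ∫ z, ambiguity γ φ z * f (tfShift z G) = (∫ s, γ s * G s) * f φ := by
  have h := SchwartzMap.integral_pairing_eq
    (continuous_ambiguity_smul_tfShift γ φ G)
    (integrable_seminorm_ambiguity_smul_tfShift γ φ G)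
    (integral_ambiguity_mul_tfShift_apply γ φ G) f
  simpa only [map_smul, smul_eq_mul] using h

/-! ### Weighted norms of short-time Fourier transforms. -/

/-- A measurable submultiplicative weight on the time-frequency plane of polynomial growth. -/
structure IsControlWeight (ν : ℝ × ℝ → ℝ≥0∞) : Prop where
  measurable : Measurable ν
  map_add_le : ∀ z w, ν (z + w) ≤ ν z * ν w
  one_le_zero : 1 ≤ ν 0
  growth : ∃ (D : ℝ) (M : ℕ), 0 ≤ D ∧ ∀ z, ν z ≤ ENNReal.ofReal (D * (1 + ‖z‖) ^ M)

/-- The weighted `L¹` norm of the short-time Fourier transform with window `G`. -/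
noncomputable def stftNorm (ν : ℝ × ℝ → ℝ≥0∞) (G : 𝓢(ℝ, ℂ)) (f : 𝓢'(ℝ, ℂ)) : ℝ≥0∞ :=
  ∫⁻ z, ‖f (tfShift z G)‖ₑ * ν z

/-- The function `(1 + ‖u‖)⁻ᴺ`. -/
noncomputable def decay (N : ℕ) (u : ℝ × ℝ) : ℝ≥0∞ := ENNReal.ofReal (((1 + ‖u‖) ^ N)⁻¹)

theorem measurable_decay (N : ℕ) : Measurable (decay N) := by
  unfold decay
  fun_prop

theorem continuous_stft (f : 𝓢'(ℝ, ℂ)) (G : 𝓢(ℝ, ℂ)) : Continuous fun z ↦ f (tfShift z G) :=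
  (map_continuous f).comp (continuous_tfShift G)

theorem measurable_enorm_stft (f : 𝓢'(ℝ, ℂ)) (G : 𝓢(ℝ, ℂ)) :
    Measurable fun z ↦ ‖f (tfShift z G)‖ₑ :=
  (continuous_stft f G).enorm.measurable

theorem measurable_lintegral_convolution {k F : ℝ × ℝ → ℝ≥0∞} (hk : Measurable k)
    (hF : Measurable F) : Measurable fun w ↦ ∫⁻ z, k (z - w) * F z :=
  Measurable.lintegral_prod_right (by fun_prop)

namespace IsControlWeight

variable {ν : ℝ × ℝ → ℝ≥0∞}

theorem lt_top (hν : IsControlWeight ν) (z : ℝ × ℝ) : ν z < ∞ := by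
  obtain ⟨D, M, -, h⟩ := hν.growth
  exact (h z).trans_lt ENNReal.ofReal_lt_top

theorem exists_decay (hν : IsControlWeight ν) :
    ∃ N : ℕ, ∫⁻ u, decay N u * ν (-u) < ∞ ∧ ∃ C < ∞, ∀ u, decay N u ≤ C * ν u := by
  obtain ⟨D, M, hD, h⟩ := hν.growth
  have key : ∀ u, decay (M + 3) u * ν (-u) ≤ ENNReal.ofReal (D * ((1 + ‖u‖) ^ 3)⁻¹) := fun u ↦ by
    have h1 := h (-u)
    rw [norm_neg] at h1
    refine (mul_le_mul_right h1 _).trans_eq ?_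
    rw [decay, ← ENNReal.ofReal_mul (by positivity)]
    congr 1
    have : (1 + ‖u‖) ≠ 0 := by positivity
    rw [pow_add]
    field_simp
  refine ⟨M + 3, ?_, ENNReal.ofReal D, ENNReal.ofReal_lt_top, fun u ↦ ?_⟩
  · refine (lintegral_mono key).trans_lt ?_
    exact (integrable_inv_one_add_norm_pow_three.const_mul D).lintegral_lt_top
  -- Submultiplicativity turns an upper bound at `-u` into a lower bound at `u`.
  · have h1 : 1 ≤ ν u * ν (-u) := by
      simpa using hν.one_le_zero.trans (by simpa using hν.map_add_le u (-u))
    calc decay (M + 3) u = decay (M + 3) u * 1 := (mul_one _).symm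
      _ ≤ decay (M + 3) u * (ν u * ν (-u)) := by gcongr
      _ = decay (M + 3) u * ν (-u) * ν u := by ring
      _ ≤ ENNReal.ofReal D * ν u := by
        gcongr
        refine (key u).trans (ENNReal.ofReal_le_ofReal (mul_le_of_le_one_right hD ?_))
        exact inv_le_one_of_one_le₀ (one_le_pow₀ (by linarith [norm_nonneg u]))

/-- Young's inequality in the weighted space `L¹_ν`. -/
theorem lintegral_convolution_le (hν : IsControlWeight ν) {k F : ℝ × ℝ → ℝ≥0∞}
    (hk : Measurable k) (hF : Measurable F) :
    ∫⁻ w, (∫⁻ z, k (z - w) * F z) * ν w ≤ (∫⁻ u, k u * ν (-u)) * ∫⁻ z, F z * ν z := by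
  have hm := hν.measurable
  calc ∫⁻ w, (∫⁻ z, k (z - w) * F z) * ν w
      = ∫⁻ w, ∫⁻ z, k (z - w) * F z * ν w := by
        congr 1
        funext w
        rw [lintegral_mul_const _ (by fun_prop)]
    _ ≤ ∫⁻ w, ∫⁻ z, (k (z - w) * ν (-(z - w))) * (F z * ν z) := by
        refine lintegral_mono fun w ↦ lintegral_mono fun z ↦ ?_
        calc k (z - w) * F z * ν w ≤ k (z - w) * F z * (ν (-(z - w)) * ν z) := by
              gcongr
              simpa using hν.map_add_le (-(z - w)) z
          _ = _ := by ring
    _ = ∫⁻ z, ∫⁻ w, (k (z - w) * ν (-(z - w))) * (F z * ν z) :=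
        lintegral_lintegral_swap (by fun_prop)
    _ = ∫⁻ z, (∫⁻ u, k u * ν (-u)) * (F z * ν z) := by
        congr 1
        funext z
        rw [lintegral_mul_const _ (by fun_prop),
          lintegral_sub_left_eq_self (fun u ↦ k u * ν (-u)) z]
    _ = _ := lintegral_const_mul _ (by fun_prop)

end IsControlWeight

theorem exists_enorm_ambiguity_le (N : ℕ) (γ φ : 𝓢(ℝ, ℂ)) :
    ∃ C < ∞, ∀ z, ‖ambiguity γ φ z‖ₑ ≤ C * decay N z := by
  obtain ⟨C, hC, h⟩ := exists_norm_ambiguity_le_div N γ φ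
  refine ⟨ENNReal.ofReal C, ENNReal.ofReal_lt_top, fun z ↦ ?_⟩
  rw [decay, ← ENNReal.ofReal_mul hC, ← ofReal_norm]
  exact ENNReal.ofReal_le_ofReal (h z)

/-- Covariance: shifting `φ` translates the modulus of its ambiguity function. The reproducing
formula thereby becomes a convolution bound, to which Young's inequality applies. -/
theorem norm_ambiguity_tfShift (γ φ : 𝓢(ℝ, ℂ)) (w z : ℝ × ℝ) :
    ‖ambiguity γ (tfShift w φ) z‖ = ‖ambiguity γ φ (z - w)‖ := by
  have h : ∀ t, γ t * tfShiftInv z (tfShift w φ) t =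
      ex (z.1 * (w.2 - z.2) + (z - w).2 * (z - w).1) * (γ t * tfShiftInv (z - w) φ t) := fun t ↦ by
    rw [tfShiftInv_tfShift, tfShiftInv_eq_smul (z - w), neg_sub, smul_apply, smul_apply,
      smul_eq_mul, smul_eq_mul, ex_add, neg_mul]
    linear_combination (-γ t * ex (z.1 * (w.2 - z.2)) * tfShift (w - z) φ t) *
      ex_mul_ex_neg ((z - w).2 * (z - w).1)
  simp only [ambiguity, h]
  rw [integral_const_mul, norm_mul, norm_ex, one_mul]

theorem enorm_apply_le_lintegral {γ G : 𝓢(ℝ, ℂ)} (hγ : ∫ t, γ t * G t = 1) (f : 𝓢'(ℝ, ℂ))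
    (φ : 𝓢(ℝ, ℂ)) : ‖f φ‖ₑ ≤ ∫⁻ z, ‖ambiguity γ φ z‖ₑ * ‖f (tfShift z G)‖ₑ := by
  have h := integral_ambiguity_mul_apply_tfShift γ φ G f
  rw [hγ, one_mul] at h
  rw [← h]
  refine (enorm_integral_le_lintegral_enorm _).trans_eq ?_
  simp only [enorm_mul]

theorem enorm_stft_le_lintegral {γ G : 𝓢(ℝ, ℂ)} (hγ : ∫ t, γ t * G t = 1) (f : 𝓢'(ℝ, ℂ))
    (φ : 𝓢(ℝ, ℂ)) (w : ℝ × ℝ) :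
    ‖f (tfShift w φ)‖ₑ ≤ ∫⁻ z, ‖ambiguity γ φ (z - w)‖ₑ * ‖f (tfShift z G)‖ₑ := by
  refine (enorm_apply_le_lintegral hγ f _).trans_eq ?_
  congr 1
  funext z
  rw [← ofReal_norm, norm_ambiguity_tfShift, ofReal_norm]

theorem decay_add_le (N : ℕ) {u r : ℝ × ℝ} (hr : ‖r‖ ≤ 1) :
    decay N (u + r) ≤ 2 ^ N * decay N u := by
  have e : (2 : ℝ≥0∞) = ENNReal.ofReal 2 := by simp
  rw [decay, decay, e, ← ENNReal.ofReal_pow zero_le_two, ← ENNReal.ofReal_mul (by positivity)]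
  refine ENNReal.ofReal_le_ofReal ?_
  rw [← div_eq_mul_inv, inv_eq_one_div, div_le_div_iff₀ (by positivity) (by positivity), one_mul,
    ← mul_pow]
  refine pow_le_pow_left₀ (by positivity) ?_ N
  have h : ‖u‖ ≤ ‖u + r‖ + ‖r‖ := by simpa using norm_sub_le (u + r) r
  linarith [norm_nonneg (u + r)]

/-- A smooth local maximal bound for short-time Fourier transforms. -/
theorem exists_stft_sub_le (N : ℕ) {γ G : 𝓢(ℝ, ℂ)} (hγ : ∫ t, γ t * G t = 1) (φ : 𝓢(ℝ, ℂ)) :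
    ∃ C < ∞, ∀ (f : 𝓢'(ℝ, ℂ)) (w r : ℝ × ℝ), ‖r‖ ≤ 1 →
      ‖f (tfShift (w - r) φ)‖ₑ ≤ C * ∫⁻ z, decay N (z - w) * ‖f (tfShift z G)‖ₑ := by
  obtain ⟨C, hC, h⟩ := exists_enorm_ambiguity_le N γ φ
  refine ⟨C * 2 ^ N, ENNReal.mul_lt_top hC (by finiteness), fun f w r hr ↦ ?_⟩
  refine (enorm_stft_le_lintegral hγ f φ _).trans ?_
  have hm := measurable_enorm_stft f G
  have hd := measurable_decay N
  rw [← lintegral_const_mul _ (by fun_prop)]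
  refine lintegral_mono fun z ↦ ?_
  simp only
  rw [← mul_assoc]
  gcongr
  calc _ ≤ C * decay N (z - (w - r)) := h _
    _ ≤ C * (2 ^ N * decay N (z - w)) := by
      gcongr
      rw [show z - (w - r) = z - w + r by abel]
      exact decay_add_le N hr
    _ = _ := by ring

variable {ν : ℝ × ℝ → ℝ≥0∞}

/-- The norm with an arbitrary Schwartz window is controlled by the norm with window `G`. -/
theorem exists_stftNorm_le (hν : IsControlWeight ν) {γ G : 𝓢(ℝ, ℂ)} (hγ : ∫ t, γ t * G t = 1)
    (φ : 𝓢(ℝ, ℂ)) : ∃ C < ∞, ∀ f : 𝓢'(ℝ, ℂ), stftNorm ν φ f ≤ C * stftNorm ν G f := by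
  obtain ⟨N, hN, -⟩ := hν.exists_decay
  obtain ⟨C, hC, h⟩ := exists_stft_sub_le N hγ φ
  refine ⟨C * ∫⁻ u, decay N u * ν (-u), ENNReal.mul_lt_top hC hN, fun f ↦ ?_⟩
  have hm := measurable_enorm_stft f G
  have hd := measurable_decay N
  have hνm := hν.measurable
  calc stftNorm ν φ f ≤ ∫⁻ w, C * ((∫⁻ z, decay N (z - w) * ‖f (tfShift z G)‖ₑ) * ν w) := by
        refine lintegral_mono fun w ↦ ?_
        simp only
        rw [← mul_assoc]
        gcongr
        simpa using h f w 0 (by simp)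
    _ = C * ∫⁻ w, (∫⁻ z, decay N (z - w) * ‖f (tfShift z G)‖ₑ) * ν w :=
        lintegral_const_mul _ ((measurable_lintegral_convolution hd hm).mul hνm)
    _ ≤ C * ((∫⁻ u, decay N u * ν (-u)) * stftNorm ν G f) := by
        gcongr
        exact hν.lintegral_convolution_le hd hm
    _ = _ := by ring

/-- The modulation space embeds continuously into the tempered distributions. -/
theorem exists_enorm_apply_le (hν : IsControlWeight ν) {γ G : 𝓢(ℝ, ℂ)}
    (hγ : ∫ t, γ t * G t = 1) (φ : 𝓢(ℝ, ℂ)) :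
    ∃ C < ∞, ∀ f : 𝓢'(ℝ, ℂ), ‖f φ‖ₑ ≤ C * stftNorm ν G f := by
  obtain ⟨N, -, D, hD, h'⟩ := hν.exists_decay
  obtain ⟨C, hC, h⟩ := exists_enorm_ambiguity_le N γ φ
  refine ⟨C * D, ENNReal.mul_lt_top hC hD, fun f ↦ ?_⟩
  have hm := measurable_enorm_stft f G
  have hνm := hν.measurable
  refine (enorm_apply_le_lintegral hγ f φ).trans ?_
  rw [stftNorm, ← lintegral_const_mul _ (by fun_prop)]
  refine lintegral_mono fun z ↦ ?_
  calc _ ≤ C * (D * ν z) * ‖f (tfShift z G)‖ₑ := by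
        gcongr
        exact (h z).trans (by gcongr; exact h' z)
    _ = _ := by ring

theorem ambiguity_tfShiftInv (γ φ : 𝓢(ℝ, ℂ)) (z w : ℝ × ℝ) :
    ambiguity γ (tfShiftInv z φ) w = ex (w.2 * z.1) * ambiguity γ φ (z + w) := by
  simp only [ambiguity]
  rw [← integral_const_mul]
  congr 1
  funext t
  rw [tfShiftInv_tfShiftInv, smul_apply, smul_eq_mul]
  ring

/-- Moving the shift from `φ` to `γ` lets an ambiguity function of `tfShiftInv z φ` be read as one
with window `φ` in the variable `z`. -/
theorem ambiguity_eq_integral_tfShift_mul (γ φ : 𝓢(ℝ, ℂ)) (w : ℝ × ℝ) :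
    ambiguity γ φ w = ∫ t, tfShift (w.1, -w.2) γ t * φ t := by
  rw [ambiguity, ← integral_sub_right_eq_self _ w.1]
  congr 1
  funext t
  rw [tfShiftInv_apply, tfShift_apply, sub_add_cancel]
  ring

/-- The orthogonality relation for two tempered distributions in the modulation space. -/
theorem integral_stft_mul_apply_tfShiftInv (hν : IsControlWeight ν) {γ G : 𝓢(ℝ, ℂ)}
    (hγ : ∫ t, γ t * G t = 1) {f f₀ : 𝓢'(ℝ, ℂ)} {h : 𝓢(ℝ, ℂ)} (hf : stftNorm ν h f < ∞)
    (hf₀ : stftNorm ν G f₀ < ∞) (φ : 𝓢(ℝ, ℂ)) :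
    ∫ z, f (tfShift z h) * f₀ (tfShiftInv z φ) = f φ * f₀ h := by
  obtain ⟨N, -, D, hD, h'⟩ := hν.exists_decay
  obtain ⟨C, hC, hN⟩ := exists_enorm_ambiguity_le N γ φ
  have hc : Continuous fun p : (ℝ × ℝ) × (ℝ × ℝ) ↦
      f (tfShift p.1 h) * (ambiguity γ (tfShiftInv p.1 φ) p.2 * f₀ (tfShift p.2 G)) := by
    have h1 := (continuous_stft f h).comp (continuous_fst (X := ℝ × ℝ) (Y := ℝ × ℝ))
    have h2 := (continuous_stft f₀ G).comp (continuous_snd (X := ℝ × ℝ) (Y := ℝ × ℝ))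
    have h3 : Continuous fun p : (ℝ × ℝ) × (ℝ × ℝ) ↦ ambiguity γ φ (p.1 + p.2) :=
      (continuous_ambiguity γ φ).comp (continuous_fst.add continuous_snd)
    have h4 : Continuous fun p : (ℝ × ℝ) × (ℝ × ℝ) ↦ ex (p.2.2 * p.1.1) :=
      continuous_ex.comp (by fun_prop)
    simp only [ambiguity_tfShiftInv]
    exact h1.mul ((h4.mul h3).mul h2)
  have hm := measurable_enorm_stft f h
  have hm₀ := measurable_enorm_stft f₀ G
  have hνm := hν.measurable
  have hp : Measurable fun z ↦ ‖f (tfShift z h)‖ₑ * ν z := hm.mul hνm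
  have hp₀ : Measurable fun z ↦ ‖f₀ (tfShift z G)‖ₑ * ν z := hm₀.mul hνm
  -- The ambiguity factor at `z + w` is at most a constant times `ν (z + w) ≤ ν z * ν w`, so the
  -- double integral is bounded by the product of the two norms.
  have hint : Integrable (fun p : (ℝ × ℝ) × (ℝ × ℝ) ↦
      f (tfShift p.1 h) * (ambiguity γ (tfShiftInv p.1 φ) p.2 * f₀ (tfShift p.2 G)))
      ((volume : Measure (ℝ × ℝ)).prod volume) := by
    refine ⟨hc.aestronglyMeasurable, ?_⟩
    rw [HasFiniteIntegral, lintegral_prod _ hc.enorm.measurable.aemeasurable]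
    calc _ ≤ ∫⁻ z, ∫⁻ w, (C * D * (‖f (tfShift z h)‖ₑ * ν z)) * (‖f₀ (tfShift w G)‖ₑ * ν w) := by
          gcongr with z w
          rw [enorm_mul, enorm_mul, ambiguity_tfShiftInv, enorm_mul]
          have e1 : ‖ex (w.2 * z.1)‖ₑ = 1 := by rw [← ofReal_norm, norm_ex]; simp
          rw [e1, one_mul]
          calc _ ≤ ‖f (tfShift z h)‖ₑ * (C * (D * (ν z * ν w)) * ‖f₀ (tfShift w G)‖ₑ) := by
                gcongr
                refine (hN _).trans ?_
                gcongr
                refine (h' _).trans ?_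
                gcongr
                exact hν.map_add_le z w
            _ = _ := by ring
      _ = C * D * stftNorm ν h f * stftNorm ν G f₀ := by
          simp only [lintegral_const_mul _ hp₀]
          rw [lintegral_mul_const _ (by fun_prop), lintegral_const_mul _ hp]
          rfl
      _ < ∞ := by finiteness
  -- Expand the factor with `f₀` by the relation for one distribution, exchange the integrals, and
  -- apply that relation to `f` in `z` and to `f₀` in `w`.
  calc ∫ z, f (tfShift z h) * f₀ (tfShiftInv z φ)
      = ∫ z, ∫ w, f (tfShift z h) * (ambiguity γ (tfShiftInv z φ) w * f₀ (tfShift w G)) := by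
        congr 1
        funext z
        rw [integral_const_mul, integral_ambiguity_mul_apply_tfShift, hγ, one_mul]
    _ = ∫ w, ∫ z, f (tfShift z h) * (ambiguity γ (tfShiftInv z φ) w * f₀ (tfShift w G)) :=
        integral_integral_swap hint
    _ = ∫ w, f φ * (ambiguity γ h w * f₀ (tfShift w G)) := by
        congr 1
        funext w
        have e : ∀ z, f (tfShift z h) * (ambiguity γ (tfShiftInv z φ) w * f₀ (tfShift w G)) =
            ambiguity (tfShift (w.1, -w.2) γ) φ z * f (tfShift z h) * f₀ (tfShift w G) := fun z ↦ by
          rw [ambiguity_eq_integral_tfShift_mul γ _ w, ambiguity]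
          ring
        simp only [e]
        rw [integral_mul_const, integral_ambiguity_mul_apply_tfShift,
          ← ambiguity_eq_integral_tfShift_mul]
        ring
    _ = f φ * f₀ h := by
        rw [integral_const_mul, integral_ambiguity_mul_apply_tfShift, hγ, one_mul]

/-- Dominated convergence: `S` bounds all small translates of `H` at once, so `2 * (S y * ν y)` is a
majorant independent of `r`. -/
theorem tendsto_lintegral_twisted_sub {H : ℝ × ℝ → ℂ} (hH : Continuous H) {S : ℝ × ℝ → ℝ≥0∞}
    (hνm : Measurable ν) (hν : ∀ z, ν z < ∞) (hSm : Measurable S) (hfin : ∫⁻ y, S y * ν y < ∞)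
    (hS : ∀ y r, ‖r‖ ≤ 1 → ‖H (y - r)‖ₑ ≤ S y) :
    Tendsto (fun r : ℝ × ℝ ↦ ∫⁻ y, ‖ex (r.1 * (y.2 - r.2)) * H (y - r) - H y‖ₑ * ν y)
      (𝓝 0) (𝓝 0) := by
  have hcr : ∀ r : ℝ × ℝ, Continuous fun y : ℝ × ℝ ↦ ex (r.1 * (y.2 - r.2)) * H (y - r) - H y :=
    fun r ↦ ((continuous_ex.comp (by fun_prop)).mul (by fun_prop)).sub hH
  have hcy : ∀ y : ℝ × ℝ, Continuous fun r : ℝ × ℝ ↦ ex (r.1 * (y.2 - r.2)) * H (y - r) - H y :=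
    fun y ↦ ((continuous_ex.comp (by fun_prop)).mul (by fun_prop)).sub continuous_const
  have hfin' : ∫⁻ y, 2 * (S y * ν y) ≠ ∞ := by
    rw [lintegral_const_mul _ (by fun_prop)]
    finiteness
  have hlim := tendsto_lintegral_filter_of_dominated_convergence (μ := volume)
    (l := 𝓝 (0 : ℝ × ℝ)) (F := fun r y ↦ ‖ex (r.1 * (y.2 - r.2)) * H (y - r) - H y‖ₑ * ν y)
    (f := fun _ ↦ 0) (fun y ↦ 2 * (S y * ν y))
    (Eventually.of_forall fun r ↦ ((hcr r).enorm.measurable.mul hνm)) ?_ hfin' ?_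
  · simpa using hlim
  · filter_upwards [Metric.closedBall_mem_nhds (0 : ℝ × ℝ) one_pos] with r hr
    refine ae_of_all _ fun y ↦ ?_
    rw [← mul_assoc]
    gcongr
    refine enorm_sub_le.trans ?_
    have e1 : ‖ex (r.1 * (y.2 - r.2))‖ₑ = 1 := by rw [← ofReal_norm, norm_ex]; simp
    rw [enorm_mul, e1, one_mul, two_mul]
    refine add_le_add (hS y r (mem_closedBall_zero_iff.1 hr)) ?_
    simpa using hS y 0 (by simp)
  · refine ae_of_all _ fun y ↦ ?_
    have h1 := ((hcy y).enorm.tendsto 0)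
    have h2 := ENNReal.Tendsto.mul_const (b := ν y) h1 (Or.inr (hν y).ne)
    simpa using h2

/-- Time-frequency shifts act strongly continuously on the modulation space. -/
theorem tendsto_lintegral_stft_sub (hν : IsControlWeight ν) {γ G : 𝓢(ℝ, ℂ)}
    (hγ : ∫ t, γ t * G t = 1) {f : 𝓢'(ℝ, ℂ)} (hf : stftNorm ν G f < ∞) :
    Tendsto (fun r : ℝ × ℝ ↦ ∫⁻ y, ‖ex (r.1 * (y.2 - r.2)) * f (tfShift (y - r) G) -
      f (tfShift y G)‖ₑ * ν y) (𝓝 0) (𝓝 0) := by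
  obtain ⟨N, hN, -⟩ := hν.exists_decay
  obtain ⟨C, hC, h⟩ := exists_stft_sub_le N hγ G
  have hm := measurable_enorm_stft f G
  have hd := measurable_decay N
  have hSm := measurable_lintegral_convolution hd hm
  have hfin : ∫⁻ w, C * (∫⁻ z, decay N (z - w) * ‖f (tfShift z G)‖ₑ) * ν w < ∞ := by
    have e : ∀ w, C * (∫⁻ z, decay N (z - w) * ‖f (tfShift z G)‖ₑ) * ν w =
        C * ((∫⁻ z, decay N (z - w) * ‖f (tfShift z G)‖ₑ) * ν w) := fun w ↦ mul_assoc _ _ _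
    rw [lintegral_congr e, lintegral_const_mul' _ _ hC.ne]
    exact ENNReal.mul_lt_top hC ((hν.lintegral_convolution_le hd hm).trans_lt
      (ENNReal.mul_lt_top hN hf))
  exact tendsto_lintegral_twisted_sub (H := fun y ↦ f (tfShift y G))
    (S := fun w ↦ C * ∫⁻ z, decay N (z - w) * ‖f (tfShift z G)‖ₑ)
    (continuous_stft f G) hν.measurable hν.lt_top (hSm.const_mul C) hfin (h f)

/-! ### Discretized reconstruction and successive approximation. -/

/-- The point of the lattice `δ ℤ²` at the lower left corner of the cell that contains `z`. -/
noncomputable def gridPoint (δ : ℝ) (z : ℝ × ℝ) : ℝ × ℝ := (δ * ⌊z.1 / δ⌋, δ * ⌊z.2 / δ⌋)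

theorem measurable_gridPoint (δ : ℝ) : Measurable (gridPoint δ) := by
  unfold gridPoint
  fun_prop

/-- The map factors through the countable discrete space `ℤ × ℤ`, so an arbitrary `w` is allowed.
This is the purpose of the lattice. -/
theorem stronglyMeasurable_comp_gridPoint {B : Type*} [TopologicalSpace B] (w : ℝ × ℝ → B)
    (δ : ℝ) : StronglyMeasurable fun z ↦ w (gridPoint δ z) := by
  have h : StronglyMeasurable fun n : ℤ × ℤ ↦ w (δ * n.1, δ * n.2) := StronglyMeasurable.of_discrete
  have hm : Measurable fun z : ℝ × ℝ ↦ ((⌊z.1 / δ⌋, ⌊z.2 / δ⌋) : ℤ × ℤ) :=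
    (Int.measurable_floor.comp (by fun_prop)).prodMk (Int.measurable_floor.comp (by fun_prop))
  exact h.comp_measurable hm

theorem norm_sub_gridPoint_lt {δ : ℝ} (hδ : 0 < δ) (z : ℝ × ℝ) : ‖z - gridPoint δ z‖ < δ := by
  have key : ∀ x : ℝ, |x - δ * ⌊x / δ⌋| < δ := fun x ↦ by
    have h : x - δ * ⌊x / δ⌋ = δ * Int.fract (x / δ) := by
      rw [Int.fract, mul_sub, mul_div_cancel₀ _ hδ.ne']
    rw [h, abs_of_nonneg (mul_nonneg hδ.le (Int.fract_nonneg _))]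
    exact mul_lt_of_lt_one_right hδ (Int.fract_lt_one _)
  rw [Prod.norm_def]
  exact max_lt (key z.1) (key z.2)

theorem IsControlWeight.exists_le_mul {ν : ℝ × ℝ → ℝ≥0∞} (hν : IsControlWeight ν) :
    ∃ K < ∞, ∀ z r, ‖r‖ ≤ 1 → ν (z - r) ≤ K * ν z := by
  obtain ⟨D, M, hD, h⟩ := hν.growth
  refine ⟨ENNReal.ofReal (D * 2 ^ M), ENNReal.ofReal_lt_top, fun z r hr ↦ ?_⟩
  rw [sub_eq_add_neg, add_comm]
  refine (hν.map_add_le _ _).trans ?_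
  gcongr
  refine (h _).trans (ENNReal.ofReal_le_ofReal ?_)
  rw [norm_neg]
  gcongr
  linarith

section Discretization

variable {B : Type*} [NormedAddCommGroup B] [NormedSpace ℂ B] {ι : B →L[ℂ] 𝓢'(ℝ, ℂ)}
  {ν : ℝ × ℝ → ℝ≥0∞} {f₀ : 𝓢'(ℝ, ℂ)} {w : ℝ × ℝ → B} {K₀ : ℝ≥0∞}

/-- The phase factor that aligns the time-frequency shift by `z` with that by `gridPoint δ z`. -/
noncomputable def gridPhase (δ : ℝ) (z : ℝ × ℝ) : ℂ :=
  ex (-((gridPoint δ z).1 * (z.2 - (gridPoint δ z).2)))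

theorem measurable_gridPhase (δ : ℝ) : Measurable (gridPhase δ) := by
  have h := measurable_gridPoint δ
  exact continuous_ex.measurable.comp (by fun_prop)

theorem enorm_ex (s : ℝ) : ‖ex s‖ₑ = 1 := by
  rw [← ofReal_norm, norm_ex, ENNReal.ofReal_one]

/-- The integrand of the discretized reconstruction formula. -/
noncomputable def gridIntegrand (w : ℝ × ℝ → B) (h : 𝓢(ℝ, ℂ)) (δ : ℝ) (f : 𝓢'(ℝ, ℂ))
    (z : ℝ × ℝ) : B :=
  (f (tfShift z h) * gridPhase δ z) • w (gridPoint δ z)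

theorem stronglyMeasurable_gridIntegrand (w : ℝ × ℝ → B) (h : 𝓢(ℝ, ℂ)) (δ : ℝ)
    (f : 𝓢'(ℝ, ℂ)) : StronglyMeasurable (gridIntegrand w h δ f) :=
  ((continuous_stft f h).stronglyMeasurable.mul
    (measurable_gridPhase δ).stronglyMeasurable).smul (stronglyMeasurable_comp_gridPoint w δ)

theorem enorm_gridIntegrand_le (hw : ∀ z, ‖w z‖ₑ ≤ K₀ * ν z) {K : ℝ≥0∞}
    (hK : ∀ z r, ‖r‖ ≤ 1 → ν (z - r) ≤ K * ν z) {δ : ℝ} (hδ : 0 < δ) (hδ₁ : δ ≤ 1)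
    (h : 𝓢(ℝ, ℂ)) (f : 𝓢'(ℝ, ℂ)) (z : ℝ × ℝ) :
    ‖gridIntegrand w h δ f z‖ₑ ≤ K₀ * K * (‖f (tfShift z h)‖ₑ * ν z) := by
  have h1 := hK z (z - gridPoint δ z) ((norm_sub_gridPoint_lt hδ z).le.trans hδ₁)
  rw [sub_sub_cancel] at h1
  rw [gridIntegrand, enorm_smul, enorm_mul, gridPhase, enorm_ex, mul_one]
  calc _ ≤ ‖f (tfShift z h)‖ₑ * (K₀ * (K * ν z)) := by
        gcongr
        exact (hw _).trans (by gcongr)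
    _ = _ := by ring

theorem lintegral_enorm_gridIntegrand_le (hν : IsControlWeight ν) (hw : ∀ z, ‖w z‖ₑ ≤ K₀ * ν z)
    {K : ℝ≥0∞} (hK : ∀ z r, ‖r‖ ≤ 1 → ν (z - r) ≤ K * ν z) {δ : ℝ} (hδ : 0 < δ) (hδ₁ : δ ≤ 1)
    (h : 𝓢(ℝ, ℂ)) (f : 𝓢'(ℝ, ℂ)) :
    ∫⁻ z, ‖gridIntegrand w h δ f z‖ₑ ≤ K₀ * K * stftNorm ν h f := by
  refine (lintegral_mono (enorm_gridIntegrand_le hw hK hδ hδ₁ h f)).trans_eq ?_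
  have hm : Measurable fun z ↦ ‖f (tfShift z h)‖ₑ * ν z :=
    (measurable_enorm_stft f h).mul hν.measurable
  rw [lintegral_const_mul _ hm, stftNorm]

theorem integrable_gridIntegrand (hν : IsControlWeight ν) (hw : ∀ z, ‖w z‖ₑ ≤ K₀ * ν z)
    (hK₀ : K₀ < ∞) {K : ℝ≥0∞} (hK' : K < ∞) (hK : ∀ z r, ‖r‖ ≤ 1 → ν (z - r) ≤ K * ν z)
    {δ : ℝ} (hδ : 0 < δ) (hδ₁ : δ ≤ 1) {h : 𝓢(ℝ, ℂ)} {f : 𝓢'(ℝ, ℂ)}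
    (hf : stftNorm ν h f < ∞) : Integrable (gridIntegrand w h δ f) :=
  ⟨(stronglyMeasurable_gridIntegrand w h δ f).aestronglyMeasurable,
    (lintegral_enorm_gridIntegrand_le hν hw hK hδ hδ₁ h f).trans_lt (by finiteness)⟩

/-- The evaluation of the distribution `ι u` at a Schwartz function, as a functional of `u`. -/
noncomputable def evalAt (ι : B →L[ℂ] 𝓢'(ℝ, ℂ)) (φ : 𝓢(ℝ, ℂ)) : B →L[ℂ] ℂ :=
  (PointwiseConvergenceCLM.evalCLM (RingHom.id ℂ) ℂ φ).comp ι

theorem evalAt_apply (ι : B →L[ℂ] 𝓢'(ℝ, ℂ)) (φ : 𝓢(ℝ, ℂ)) (u : B) : evalAt ι φ u = ι u φ := rfl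

theorem integrable_stft_mul_apply_tfShiftInv (hν : IsControlWeight ν)
    (hιw : ∀ z φ, ι (w z) φ = f₀ (tfShiftInv z φ)) (hw : ∀ z, ‖w z‖ₑ ≤ K₀ * ν z) (hK₀ : K₀ < ∞)
    {h : 𝓢(ℝ, ℂ)} {f : 𝓢'(ℝ, ℂ)} (hf : stftNorm ν h f < ∞) (φ : 𝓢(ℝ, ℂ)) :
    Integrable fun z ↦ f (tfShift z h) * f₀ (tfShiftInv z φ) := by
  refine ⟨((continuous_stft f h).mul
    ((map_continuous f₀).comp (continuous_tfShiftInv φ))).aestronglyMeasurable, ?_⟩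
  have hm : Measurable fun z ↦ ‖f (tfShift z h)‖ₑ * ν z :=
    (measurable_enorm_stft f h).mul hν.measurable
  calc ∫⁻ z, ‖f (tfShift z h) * f₀ (tfShiftInv z φ)‖ₑ
      ≤ ∫⁻ z, ‖evalAt ι φ‖ₑ * K₀ * (‖f (tfShift z h)‖ₑ * ν z) := by
        refine lintegral_mono fun z ↦ ?_
        rw [enorm_mul, ← hιw, ← evalAt_apply]
        calc _ ≤ ‖f (tfShift z h)‖ₑ * (‖evalAt ι φ‖ₑ * (K₀ * ν z)) := by
              gcongr
              exact ((evalAt ι φ).le_opENorm _).trans (by gcongr; exact hw z)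
          _ = _ := by ring
    _ = ‖evalAt ι φ‖ₑ * K₀ * stftNorm ν h f := by rw [lintegral_const_mul _ hm, stftNorm]
    _ < ∞ := by finiteness

/-- With `p` the lattice point and `r` the offset in its cell, the phase `ex (-(p.1 * r.2))` is
exactly what makes the modulus of the difference depend on `r` and `y` only. Without it the error
would not be uniform in `p`. -/
theorem enorm_apply_tfShiftInv_sub_grid (f₀ : 𝓢'(ℝ, ℂ)) (G : 𝓢(ℝ, ℂ)) (p r y : ℝ × ℝ) :
    ‖f₀ (tfShiftInv (p + r) (tfShift (y + p) G)) -
        ex (-(p.1 * r.2)) * f₀ (tfShiftInv p (tfShift (y + p) G))‖ₑ =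
      ‖ex (r.1 * (y.2 - r.2)) * f₀ (tfShift (y - r) G) - f₀ (tfShift y G)‖ₑ := by
  rw [tfShiftInv_tfShift, tfShiftInv_tfShift, map_smul, map_smul, smul_eq_mul, smul_eq_mul,
    ← mul_assoc, ← ex_add]
  have e1 : (p + r).1 * ((y + p).2 - (p + r).2) = p.1 * (y.2 - r.2) + r.1 * (y.2 - r.2) := by
    simp only [Prod.fst_add, Prod.snd_add]
    ring
  have e2 : -(p.1 * r.2) + p.1 * ((y + p).2 - p.2) = p.1 * (y.2 - r.2) := by
    simp only [Prod.snd_add]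
    ring
  rw [e1, e2, show y + p - (p + r) = y - r by abel, add_sub_cancel_right, ex_add, mul_assoc,
    ← mul_sub, enorm_mul, enorm_ex, one_mul]

theorem stft_sub_eq_integral [CompleteSpace B] (hν : IsControlWeight ν) {γ G : 𝓢(ℝ, ℂ)}
    (hγ : ∫ t, γ t * G t = 1) (hιw : ∀ z φ, ι (w z) φ = f₀ (tfShiftInv z φ))
    (hw : ∀ z, ‖w z‖ₑ ≤ K₀ * ν z) (hK₀ : K₀ < ∞) {K : ℝ≥0∞} (hK' : K < ∞)
    (hK : ∀ z r, ‖r‖ ≤ 1 → ν (z - r) ≤ K * ν z) {δ : ℝ} (hδ : 0 < δ) (hδ₁ : δ ≤ 1)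
    {h : 𝓢(ℝ, ℂ)} (hf₀h : f₀ h = 1) {f : 𝓢'(ℝ, ℂ)} (hf : stftNorm ν h f < ∞)
    (hf₀ : stftNorm ν G f₀ < ∞) (φ : 𝓢(ℝ, ℂ)) :
    (f - ι (∫ z, gridIntegrand w h δ f z)) φ = ∫ z, f (tfShift z h) *
      (f₀ (tfShiftInv z φ) - gridPhase δ z * f₀ (tfShiftInv (gridPoint δ z) φ)) := by
  have hP := integrable_gridIntegrand hν hw hK₀ hK' hK hδ hδ₁ hf
  have h1 := (evalAt ι φ).integral_comp_comm hP
  have h2 := (evalAt ι φ).integrable_comp hP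
  have e : ∀ z, evalAt ι φ (gridIntegrand w h δ f z) = f (tfShift z h) *
      (gridPhase δ z * f₀ (tfShiftInv (gridPoint δ z) φ)) := fun z ↦ by
    rw [gridIntegrand, map_smul, evalAt_apply, hιw, smul_eq_mul, mul_assoc]
  simp only [e] at h1 h2
  have h3 := integral_stft_mul_apply_tfShiftInv hν hγ hf hf₀ φ
  rw [hf₀h, mul_one] at h3
  have h4 := integral_sub (integrable_stft_mul_apply_tfShiftInv hν hιw hw hK₀ hf φ) h2
  rw [h3, h1, evalAt_apply] at h4
  simp only [mul_sub]
  exact h4.symm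

theorem lintegral_shift_le {ν : ℝ × ℝ → ℝ≥0∞} (hν : IsControlWeight ν) {D : ℝ × ℝ → ℝ≥0∞}
    (hD : Measurable D) (p : ℝ × ℝ) : ∫⁻ y, D (y - p) * ν y ≤ ν p * ∫⁻ y, D y * ν y := by
  have hm := hν.measurable
  rw [← lintegral_add_right_eq_self _ p, ← lintegral_const_mul _ (by fun_prop)]
  refine lintegral_mono fun y ↦ ?_
  rw [add_sub_cancel_right]
  calc _ ≤ D y * (ν y * ν p) := by gcongr; exact hν.map_add_le y p
    _ = _ := by ring

/-- The error of the discretized reconstruction formula. -/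
theorem stftNorm_sub_le [CompleteSpace B] (hν : IsControlWeight ν) {γ G : 𝓢(ℝ, ℂ)}
    (hγ : ∫ t, γ t * G t = 1) (hιw : ∀ z φ, ι (w z) φ = f₀ (tfShiftInv z φ))
    (hw : ∀ z, ‖w z‖ₑ ≤ K₀ * ν z) (hK₀ : K₀ < ∞) {K : ℝ≥0∞} (hK' : K < ∞)
    (hK : ∀ z r, ‖r‖ ≤ 1 → ν (z - r) ≤ K * ν z) {δ : ℝ} (hδ : 0 < δ) (hδ₁ : δ ≤ 1)
    {h : 𝓢(ℝ, ℂ)} (hf₀h : f₀ h = 1) {f : 𝓢'(ℝ, ℂ)} (hf : stftNorm ν h f < ∞)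
    (hf₀ : stftNorm ν G f₀ < ∞) {ε : ℝ≥0∞}
    (hε : ∀ r : ℝ × ℝ, ‖r‖ < δ → ∫⁻ y, ‖ex (r.1 * (y.2 - r.2)) * f₀ (tfShift (y - r) G) -
      f₀ (tfShift y G)‖ₑ * ν y ≤ ε) :
    stftNorm ν G (f - ι (∫ z, gridIntegrand w h δ f z)) ≤ K * ε * stftNorm ν h f := by
  set D : (ℝ × ℝ) × (ℝ × ℝ) → ℝ≥0∞ := fun q ↦ ‖ex (q.1.1 * (q.2.2 - q.1.2)) *
    f₀ (tfShift (q.2 - q.1) G) - f₀ (tfShift q.2 G)‖ₑ with hDdef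
  have hDm : Measurable D := by
    have h1 := (continuous_stft f₀ G).comp
      ((continuous_snd (X := ℝ × ℝ) (Y := ℝ × ℝ)).sub continuous_fst)
    have h2 := (continuous_stft f₀ G).comp (continuous_snd (X := ℝ × ℝ) (Y := ℝ × ℝ))
    exact (((continuous_ex.comp (by fun_prop)).mul h1).sub h2).enorm.measurable
  have hgm := measurable_gridPoint δ
  have hm := hν.measurable
  have hFm := measurable_enorm_stft f h
  have hjm : Measurable fun q : (ℝ × ℝ) × (ℝ × ℝ) ↦ ‖f (tfShift q.2 h)‖ₑ *
      (D (q.2 - gridPoint δ q.2, q.1 - gridPoint δ q.2) * ν q.1) := by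
    have h1 : Measurable fun q : (ℝ × ℝ) × (ℝ × ℝ) ↦
        D (q.2 - gridPoint δ q.2, q.1 - gridPoint δ q.2) := hDm.comp (by fun_prop)
    exact (hFm.comp measurable_snd).mul (h1.mul (hm.comp measurable_fst))
  have key : ∀ y, ‖(f - ι (∫ z, gridIntegrand w h δ f z)) (tfShift y G)‖ₑ ≤
      ∫⁻ z, ‖f (tfShift z h)‖ₑ * D (z - gridPoint δ z, y - gridPoint δ z) := fun y ↦ by
    rw [stft_sub_eq_integral hν hγ hιw hw hK₀ hK' hK hδ hδ₁ hf₀h hf hf₀]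
    refine (enorm_integral_le_lintegral_enorm _).trans_eq (lintegral_congr fun z ↦ ?_)
    rw [enorm_mul]
    congr 1
    have := enorm_apply_tfShiftInv_sub_grid f₀ G (gridPoint δ z) (z - gridPoint δ z)
      (y - gridPoint δ z)
    rw [add_sub_cancel, sub_add_cancel] at this
    exact this
  calc stftNorm ν G (f - ι (∫ z, gridIntegrand w h δ f z))
      ≤ ∫⁻ y, ∫⁻ z, ‖f (tfShift z h)‖ₑ *
        (D (z - gridPoint δ z, y - gridPoint δ z) * ν y) := by
        refine lintegral_mono fun y ↦ ?_
        refine (mul_le_mul_left (key y) _).trans_eq ?_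
        rw [← lintegral_mul_const' _ _ (hν.lt_top y).ne]
        simp only [mul_assoc]
    _ = ∫⁻ z, ∫⁻ y, ‖f (tfShift z h)‖ₑ *
        (D (z - gridPoint δ z, y - gridPoint δ z) * ν y) :=
        lintegral_lintegral_swap hjm.aemeasurable
    _ ≤ ∫⁻ z, K * ε * (‖f (tfShift z h)‖ₑ * ν z) := by
        refine lintegral_mono fun z ↦ ?_
        rw [lintegral_const_mul' _ _ enorm_ne_top]
        have hr := norm_sub_gridPoint_lt hδ z
        have h1 : ν (gridPoint δ z) ≤ K * ν z := by
          have := hK z (z - gridPoint δ z) (hr.le.trans hδ₁)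
          rwa [sub_sub_cancel] at this
        -- Undoing the translation by the lattice point costs `ν (gridPoint δ z) ≤ K * ν z`; what
        -- remains is the modulus of continuity of shifts at `f₀`.
        calc _ ≤ ‖f (tfShift z h)‖ₑ * (K * ν z * ε) := by
              gcongr
              refine (lintegral_shift_le hν (D := fun y ↦ D (z - gridPoint δ z, y))
                (hDm.comp (by fun_prop)) _).trans ?_
              gcongr
              exact hε _ hr
          _ = _ := by ring
    _ = _ := by
        have hp : Measurable fun z ↦ ‖f (tfShift z h)‖ₑ * ν z := hFm.mul hm
        rw [lintegral_const_mul _ hp, stftNorm]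

/-- The mesh is chosen from `f₀` and `h` alone, so one constant and one contraction factor serve
every `f`. -/
theorem exists_approx [CompleteSpace B] (hν : IsControlWeight ν) {γ G : 𝓢(ℝ, ℂ)}
    (hγ : ∫ t, γ t * G t = 1) (hιw : ∀ z φ, ι (w z) φ = f₀ (tfShiftInv z φ))
    (hw : ∀ z, ‖w z‖ₑ ≤ K₀ * ν z) (hK₀ : K₀ < ∞) (hne : f₀ ≠ 0)
    (hf₀ : stftNorm ν G f₀ < ∞) :
    ∃ C < ∞, ∀ f : 𝓢'(ℝ, ℂ), stftNorm ν G f < ∞ → ∃ u : B,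
      ‖u‖ₑ ≤ C * stftNorm ν G f ∧ stftNorm ν G (f - ι u) ≤ 2⁻¹ * stftNorm ν G f := by
  obtain ⟨h, hf₀h⟩ : ∃ h, f₀ h = 1 := by
    obtain ⟨h, hh⟩ : ∃ h, f₀ h ≠ 0 := by
      by_contra! H
      exact hne (by ext φ; exact H φ)
    exact ⟨(f₀ h)⁻¹ • h, by rw [map_smul, smul_eq_mul, inv_mul_cancel₀ hh]⟩
  obtain ⟨K, hK', hK⟩ := hν.exists_le_mul
  obtain ⟨C, hC, hCh⟩ := exists_stftNorm_le hν hγ h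
  -- Chosen so that `K * ε * C ≤ 2⁻¹`; the `+ 1` keeps the denominator positive.
  set ε : ℝ≥0∞ := 2⁻¹ / (K * C + 1) with hεdef
  have hε : 0 < ε := ENNReal.div_pos (by simp) (by finiteness)
  have hεle : K * ε * C ≤ 2⁻¹ := by
    calc K * ε * C ≤ (K * C + 1) * ε := by
          rw [mul_right_comm]
          gcongr
          exact le_self_add
      _ ≤ 2⁻¹ := ENNReal.mul_div_le
  obtain ⟨η, hη, hηε⟩ := Metric.eventually_nhds_iff.1
    ((tendsto_lintegral_stft_sub hν hγ hf₀).eventually (ge_mem_nhds hε))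
  have hδ : 0 < min η 1 := lt_min hη one_pos
  refine ⟨K₀ * K * C, by finiteness, fun f hf ↦ ?_⟩
  have hfh : stftNorm ν h f < ∞ := (hCh f).trans_lt (by finiteness)
  refine ⟨∫ z, gridIntegrand w h (min η 1) f z, ?_, ?_⟩
  · refine (enorm_integral_le_lintegral_enorm _).trans ?_
    refine (lintegral_enorm_gridIntegrand_le hν hw hK hδ (min_le_right _ _) h f).trans ?_
    exact (mul_le_mul_right (hCh f) _).trans_eq (by ring)
  · refine (stftNorm_sub_le hν hγ hιw hw hK₀ hK' hK hδ (min_le_right _ _) hf₀h hfh hf₀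
      (fun r hr ↦ hηε (by rw [dist_zero_right]; exact hr.trans_le (min_le_left _ _)))).trans ?_
    calc _ ≤ K * ε * (C * stftNorm ν G f) := by gcongr; exact hCh f
      _ = K * ε * C * stftNorm ν G f := by ring
      _ ≤ _ := by gcongr

/-- An approximate preimage can be improved to a preimage by successive approximation. -/
theorem exists_preimage_of_approx [CompleteSpace B] (hν : IsControlWeight ν) {γ G : 𝓢(ℝ, ℂ)}
    (hγ : ∫ t, γ t * G t = 1) {C : ℝ≥0∞} (hC : C < ∞)
    (H : ∀ f : 𝓢'(ℝ, ℂ), stftNorm ν G f < ∞ → ∃ u : B,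
      ‖u‖ₑ ≤ C * stftNorm ν G f ∧ stftNorm ν G (f - ι u) ≤ 2⁻¹ * stftNorm ν G f)
    {f : 𝓢'(ℝ, ℂ)} (hf : stftNorm ν G f < ∞) :
    ∃ u : B, ι u = f ∧ ‖u‖ ≤ 2 * C.toReal * (stftNorm ν G f).toReal := by
  choose! σ hσ hσ' using H
  -- `g n` is the residual after `n` corrections; its norm halves at each step and bounds the next
  -- correction.
  let g : ℕ → 𝓢'(ℝ, ℂ) := fun n ↦ (fun f ↦ f - ι (σ f))^[n] f
  have g_succ : ∀ n, g (n + 1) = g n - ι (σ (g n)) := fun n ↦ Function.iterate_succ_apply' _ _ _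
  have hg : ∀ n, stftNorm ν G (g n) ≤ (2⁻¹ : ℝ≥0∞) ^ n * stftNorm ν G f := by
    intro n
    induction n with
    | zero => simp [g]
    | succ n ih =>
      rw [g_succ]
      refine (hσ' _ (ih.trans_lt (by finiteness))).trans ?_
      rw [pow_succ', mul_assoc]
      gcongr
  have hg' : ∀ n, stftNorm ν G (g n) < ∞ := fun n ↦ (hg n).trans_lt (by finiteness)
  have hu : ∀ n, ‖σ (g n)‖ ≤ C.toReal * (stftNorm ν G f).toReal * (1 / 2) ^ n := fun n ↦ by
    have h1 : ‖σ (g n)‖ₑ ≤ C * ((2⁻¹ : ℝ≥0∞) ^ n * stftNorm ν G f) :=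
      (hσ _ (hg' n)).trans (by gcongr; exact hg n)
    have h2 := ENNReal.toReal_mono (by finiteness) h1
    rw [toReal_enorm, ENNReal.toReal_mul, ENNReal.toReal_mul, ENNReal.toReal_pow,
      ENNReal.toReal_inv, ENNReal.toReal_ofNat] at h2
    refine h2.trans_eq ?_
    rw [one_div]
    ring
  have hgeo : HasSum (fun n : ℕ ↦ C.toReal * (stftNorm ν G f).toReal * (1 / 2 : ℝ) ^ n)
      (C.toReal * (stftNorm ν G f).toReal * 2) := hasSum_geometric_two.mul_left _
  have hsum : Summable fun n ↦ σ (g n) := Summable.of_norm_bounded hgeo.summable hu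
  refine ⟨∑' n, σ (g n), ?_, (tsum_of_norm_bounded hgeo hu).trans_eq (by ring)⟩
  ext φ
  have h1 : Tendsto (fun n ↦ ∑ k ∈ Finset.range n, ι (σ (g k)) φ) atTop
      (𝓝 (ι (∑' n, σ (g n)) φ)) := (hsum.hasSum.mapL (evalAt ι φ)).tendsto_sum_nat
  have h2 : ∀ n, ∑ k ∈ Finset.range n, ι (σ (g k)) φ = f φ - g n φ := fun n ↦ by
    induction n with
    | zero => simp [g]
    | succ n ih =>
      rw [Finset.sum_range_succ, ih, g_succ, sub_apply]
      ring
  -- The partial sums telescope to `f - g n`. Evaluation at `φ` is bounded by the modulation norm,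
  -- so the residuals vanish in the limit.
  obtain ⟨D, hD, hDg⟩ := exists_enorm_apply_le hν hγ φ
  have h3 : Tendsto (fun n ↦ g n φ) atTop (𝓝 0) := by
    rw [tendsto_zero_iff_enorm_tendsto_zero]
    have h4 : Tendsto (fun n : ℕ ↦ D * stftNorm ν G f * (2⁻¹ : ℝ≥0∞) ^ n) atTop (𝓝 0) := by
      have := ENNReal.Tendsto.const_mul (a := D * stftNorm ν G f)
        (ENNReal.tendsto_pow_atTop_nhds_zero_of_lt_one (r := 2⁻¹) (by simp))
        (Or.inr (by finiteness))
      simpa using this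
    refine tendsto_of_tendsto_of_tendsto_of_le_of_le tendsto_const_nhds h4 (fun _ ↦ zero_le)
      fun n ↦ ?_
    refine (hDg (g n)).trans ?_
    rw [mul_assoc, mul_comm (stftNorm ν G f)]
    gcongr
    exact hg n
  refine tendsto_nhds_unique h1 ?_
  simp only [h2]
  simpa using h3.const_sub (f φ)

end Discretization

/-! ### From the `A`-setting to ordinary time-frequency shifts. -/

theorem norm_phase (α β γ t : ℝ) : ‖phase α β γ t‖ = 1 := Complex.norm_exp_ofReal_mul_I _

theorem phase_ne_zero (α β γ t : ℝ) : phase α β γ t ≠ 0 := Complex.exp_ne_zero _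

/-- Take the complex conjugate of `G`, divided by `∫ ‖G‖ ^ 2`. -/
theorem exists_integral_mul_eq_one {G : 𝓢(ℝ, ℂ)} (hG : G ≠ 0) :
    ∃ γ : 𝓢(ℝ, ℂ), ∫ t, γ t * G t = 1 := by
  let γ : 𝓢(ℝ, ℂ) := postcompCLM (𝕜 := ℝ) (Complex.conjCLE : ℂ →L[ℝ] ℂ) G
  have hγ : ∀ t, γ t * G t = ((‖G t‖ ^ 2 : ℝ) : ℂ) := fun t ↦ by
    rw [show γ t = (starRingEnd ℂ) (G t) from rfl, mul_comm, Complex.mul_conj,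
      Complex.normSq_eq_norm_sq]
  have h0 : ∫ t, ‖G t‖ ^ 2 ≠ 0 := by
    intro h
    have hi : Integrable fun t ↦ ‖G t‖ ^ 2 := by
      have := (integrable_mul γ G).re
      simpa [hγ, ← Complex.ofReal_pow] using this
    rw [integral_eq_zero_iff_of_nonneg (fun t ↦ by positivity) hi] at h
    have h1 := (Continuous.ae_eq_iff_eq volume (by fun_prop) continuous_zero).1 h
    refine hG (SchwartzMap.ext fun t ↦ ?_)
    simpa using congrFun h1 t
  refine ⟨((∫ t, ‖G t‖ ^ 2 : ℝ) : ℂ)⁻¹ • γ, ?_⟩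
  simp only [smul_apply, smul_eq_mul, mul_assoc, hγ]
  rw [integral_const_mul, integral_complex_ofReal]
  exact inv_mul_cancel₀ (Complex.ofReal_ne_zero.2 h0)

/-- The window of the short-time Fourier transform that corresponds to the window `g` of the
`A`-modulation space. -/
noncomputable def windowOf (A : Params) (g : 𝓢(ℝ, ℂ)) : 𝓢(ℝ, ℂ) :=
  reflection (chirp (2 * A.a / A.b) g)

theorem windowOf_ne_zero (A : Params) {g : 𝓢(ℝ, ℂ)} (hg : g ≠ 0) : windowOf A g ≠ 0 := by
  intro h
  refine hg (SchwartzMap.ext fun t ↦ ?_)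
  have h1 : windowOf A g (-t) = 0 := by rw [h]; rfl
  rw [windowOf, reflection_apply, neg_neg, chirp_apply] at h1
  exact (mul_eq_zero.1 h1).resolve_left (Complex.exp_ne_zero _)

/-- Since `t² - x (t - x) = (t - x)² + x t`, the chirp is absorbed into the shifted window and
leaves the frequency `a x / b`; the modulation contributes `-ω / b`. -/
theorem chirp_translation_reflection_modulation (A : Params) (g : 𝓢(ℝ, ℂ)) (x ω : ℝ) :
    chirp (2 * A.a / A.b) (translation A x (reflection (modulation A ω g))) =
      phase 0 0 (Real.pi / A.b * (A.a * ω ^ 2 - 2 * A.p * ω + 2 * ω * x)) 0 •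
        tfShift (x, (A.a * x - ω) / A.b) (windowOf A g) := by
  have hb := A.b_ne_zero
  ext t
  rw [smul_apply, smul_eq_mul, tfShift_apply, windowOf, reflection_apply, chirp, mulPhase_apply,
    mulPhase_apply, translation, ContinuousLinearMap.comp_apply, compSubConstCLM_apply,
    mulPhase_apply, reflection_apply, modulation, mulPhase_apply, ← mul_assoc, ← mul_assoc,
    ← mul_assoc, ← mul_assoc]
  congr 1
  simp only [phase, ex, ← Complex.exp_add, ← add_mul, ← Complex.ofReal_add]
  congr 3
  field_simp
  ring

theorem enorm_conv_modulation (A : Params) (g : 𝓢(ℝ, ℂ)) (f : 𝓢'(ℝ, ℂ)) (x ω : ℝ) :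
    ‖f (tfShift (x, (A.a * x - ω) / A.b) (windowOf A g))‖ₑ =
      ENNReal.ofReal (Real.sqrt |A.b|) * ‖conv A f (modulation A ω g) x‖ₑ := by
  have hb : 0 < Real.sqrt |A.b| := Real.sqrt_pos.2 (abs_pos.2 A.b_ne_zero)
  have h1 : Complex.exp (-(2 * Real.pi * Complex.I * A.a / A.b) * x ^ 2) =
      Complex.exp ((-(2 * Real.pi * A.a / A.b) * x ^ 2 : ℝ) * Complex.I) := by
    congr 1
    push_cast
    ring
  rw [← ofReal_norm, ← ofReal_norm, ← ENNReal.ofReal_mul hb.le, conv,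
    chirp_translation_reflection_modulation, map_smul, h1, norm_mul, norm_mul, norm_smul,
    norm_phase, Complex.norm_exp_ofReal_mul_I, norm_div, norm_one, Complex.norm_real,
    Real.norm_of_nonneg hb.le]
  congr 1
  field_simp

/-- The frequency `(a x - ω) / b` is the one found for the `A`-convolution, so norms and operators
are indexed by the same phase-space point. -/
theorem modulationDist_translationDist_apply (A : Params) (x ω : ℝ) (f : 𝓢'(ℝ, ℂ))
    (φ : 𝓢(ℝ, ℂ)) : modulationDist A ω (translationDist A x f) φ =
      phase 0 0 (Real.pi / A.b * (A.a * ω ^ 2 - 2 * A.p * ω + 2 * A.a * x ^ 2)) 0 *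
        f (tfShiftInv (x, (A.a * x - ω) / A.b) φ) := by
  have hb := A.b_ne_zero
  have e : (mulPhase 0 (-(2 * Real.pi * A.a / A.b) * x) 0)
      (compSubConstCLM ℂ (-x) (modulation A ω φ)) =
      phase 0 0 (Real.pi / A.b * (A.a * ω ^ 2 - 2 * A.p * ω + 2 * A.a * x ^ 2)) 0 •
        tfShiftInv (x, (A.a * x - ω) / A.b) φ := by
    ext t
    rw [smul_apply, smul_eq_mul, tfShiftInv_apply, mulPhase_apply, compSubConstCLM_apply,
      modulation, mulPhase_apply, sub_neg_eq_add, ← mul_assoc, ← mul_assoc]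
    congr 1
    simp only [phase, ex, ← Complex.exp_add, ← add_mul, ← Complex.ofReal_add]
    congr 3
    field_simp
    ring
  rw [← smul_eq_mul, ← map_smul, ← e]
  rfl

theorem lintegral_sub_mul (F : ℝ → ℝ≥0∞) (hF : Measurable F) (c : ℝ) {b : ℝ} (hb : b ≠ 0) :
    ∫⁻ ξ, F (c - b * ξ) = ENNReal.ofReal |b⁻¹| * ∫⁻ ω, F ω := by
  have h := lintegral_map (μ := volume) (f := fun s ↦ F (c - s)) (g := fun ξ : ℝ ↦ b * ξ)
    (by fun_prop) (by fun_prop)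
  rw [Real.map_volume_mul_left hb, lintegral_smul_measure, lintegral_sub_left_eq_self,
    smul_eq_mul] at h
  exact h.symm

/-- Substitute `ω = a x - b ξ`. The constant collects `K`, the Jacobian `|b⁻¹|` and the
normalisation `√|b|` of the `A`-convolution. -/
theorem exists_stftNorm_le_modNorm (A : Params) {v : ℝ × ℝ → ℝ} (hv : Measurable v)
    (g : 𝓢(ℝ, ℂ)) {ν : ℝ × ℝ → ℝ≥0∞} {K : ℝ≥0∞} (hK : K < ∞)
    (hν : ∀ z, ν z ≤ K * ENNReal.ofReal (v (z.1, A.a * z.1 - A.b * z.2))) :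
    ∃ C < ∞, ∀ f, stftNorm ν (windowOf A g) f ≤ C * modNorm A v g 1 1 f := by
  refine ⟨K * ENNReal.ofReal |A.b⁻¹| * ENNReal.ofReal (Real.sqrt |A.b|), by finiteness,
    fun f ↦ ?_⟩
  have hb := A.b_ne_zero
  set R : ℝ × ℝ → ℝ≥0∞ := fun q ↦
    ‖f (tfShift (q.1, (A.a * q.1 - q.2) / A.b) (windowOf A g))‖ₑ * ENNReal.ofReal (v q) with hR
  have hRm : Measurable R :=
    ((measurable_enorm_stft f (windowOf A g)).comp (by fun_prop)).mul hv.ennreal_ofReal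
  have hRA : Measurable fun q : ℝ × ℝ ↦ R (q.1, A.a * q.1 - A.b * q.2) := hRm.comp (by fun_prop)
  have hmod : modNorm A v g 1 1 f = ∫⁻ ω, ∫⁻ x, ‖conv A f (modulation A ω g) x‖ₑ *
      ENNReal.ofReal (v (x, ω)) := by
    simp [modNorm]
  calc stftNorm ν (windowOf A g) f
      ≤ ∫⁻ z : ℝ × ℝ, K * R (z.1, A.a * z.1 - A.b * z.2) := by
        refine lintegral_mono fun z ↦ ?_
        have e : (A.a * z.1 - (A.a * z.1 - A.b * z.2)) / A.b = z.2 := by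
          field_simp
          ring
        simp only [hR, e]
        refine (mul_le_mul_right (hν z) _).trans_eq ?_
        ring
    _ = K * ∫⁻ z : ℝ × ℝ, R (z.1, A.a * z.1 - A.b * z.2) := lintegral_const_mul _ hRA
    _ = K * ∫⁻ x, ∫⁻ ξ, R (x, A.a * x - A.b * ξ) := by
        rw [Measure.volume_eq_prod, lintegral_prod _ hRA.aemeasurable]
    _ = K * ∫⁻ x, ENNReal.ofReal |A.b⁻¹| * ∫⁻ ω, R (x, ω) := by
        congr 2
        funext x
        exact lintegral_sub_mul (fun ω ↦ R (x, ω)) (by fun_prop) _ hb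
    _ = K * ENNReal.ofReal |A.b⁻¹| * ∫⁻ ω, ∫⁻ x, R (x, ω) := by
        rw [lintegral_const_mul' _ _ ENNReal.ofReal_ne_top, mul_assoc,
          lintegral_lintegral_swap hRm.aemeasurable]
    _ = _ := by
        rw [hmod, mul_assoc (K * ENNReal.ofReal |A.b⁻¹|),
          ← lintegral_const_mul' _ _ ENNReal.ofReal_ne_top]
        congr 1
        refine lintegral_congr fun ω ↦ ?_
        rw [← lintegral_const_mul' _ _ ENNReal.ofReal_ne_top]
        refine lintegral_congr fun x ↦ ?_
        rw [hR]
        simp only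
        rw [enorm_conv_modulation, mul_assoc]

/-! ### Shift operators on `B` and the control weight. -/

section Operators

variable {B : Type*} [NormedAddCommGroup B] [NormedSpace ℂ B] {ι : B →L[ℂ] 𝓢'(ℝ, ℂ)}

/-- A family of time-frequency shifts on `B`, bounded by `v`, consists of bounded operators. -/
theorem exists_shift_operator (hι : Function.Injective ι) {v : ℝ × ℝ → ℝ}
    (hv : ∀ z, 0 ≤ v z)
    (hB : ∀ (u : B) (z : ℝ × ℝ), ∃ w : B, (∀ φ, ι w φ = ι u (tfShiftInv z φ)) ∧
      ‖w‖ ≤ v z * ‖u‖) :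
    ∃ S : ℝ × ℝ → B →L[ℂ] B, (∀ z u φ, ι (S z u) φ = ι u (tfShiftInv z φ)) ∧
      ∀ z, ‖S z‖ ≤ v z := by
  choose w hw hwn using hB
  -- Injectivity of `ι` makes each shifted element unique, which forces linearity.
  have hext : ∀ u u' : B, (∀ φ, ι u φ = ι u' φ) → u = u' := fun u u' h ↦
    hι (by ext φ; exact h φ)
  let T : ℝ × ℝ → B →ₗ[ℂ] B := fun z ↦
    { toFun := fun u ↦ w u z
      map_add' := fun u u' ↦ hext _ _ fun φ ↦ by
        rw [hw, map_add, map_add, add_apply, add_apply, hw, hw]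
      map_smul' := fun c u ↦ hext _ _ fun φ ↦ by
        rw [hw, RingHom.id_apply, map_smul, map_smul, smul_apply, smul_apply, hw] }
  exact ⟨fun z ↦ (T z).mkContinuous (v z) fun u ↦ hwn u z, fun z u φ ↦ hw u z φ,
    fun z ↦ LinearMap.mkContinuous_norm_le _ (hv z) _⟩

/-- The local supremum of the operator norms of a family of operators. -/
noncomputable def localSup (S : ℝ × ℝ → B →L[ℂ] B) (z : ℝ × ℝ) : ℝ≥0∞ :=
  ⨆ y ∈ Metric.ball z 1, ‖S y‖ₑ

variable {S : ℝ × ℝ → B →L[ℂ] B}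

theorem enorm_le_localSup (S : ℝ × ℝ → B →L[ℂ] B) (z : ℝ × ℝ) : ‖S z‖ₑ ≤ localSup S z :=
  le_iSup₂ (f := fun y (_ : y ∈ Metric.ball z 1) ↦ ‖S y‖ₑ) z (Metric.mem_ball_self one_pos)

/-- Superlevel sets are unions of open balls, hence open, with no regularity of `S` required. This
is why a supremum replaces `‖S z‖` itself. -/
theorem measurable_localSup (S : ℝ × ℝ → B →L[ℂ] B) : Measurable (localSup S) := by
  refine measurable_of_Ioi fun c ↦ IsOpen.measurableSet ?_
  have h : localSup S ⁻¹' Set.Ioi c = ⋃ y ∈ {y | c < ‖S y‖ₑ}, Metric.ball y 1 := by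
    ext z
    simp only [localSup, Set.mem_preimage, Set.mem_Ioi, lt_iSup_iff, Set.mem_iUnion,
      Set.mem_ofPred_eq, exists_prop, Metric.mem_ball, dist_comm z, and_comm]
  rw [h]
  exact isOpen_biUnion fun _ _ ↦ Metric.isOpen_ball

theorem enorm_shift_add_le (hι : Function.Injective ι)
    (hS : ∀ z u φ, ι (S z u) φ = ι u (tfShiftInv z φ)) (z w : ℝ × ℝ) :
    ‖S (z + w)‖ₑ ≤ ‖S z‖ₑ * ‖S w‖ₑ := by
  have h : S z ∘L S w = ex (w.2 * z.1) • S (z + w) := by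
    ext u
    refine hι ?_
    ext φ
    rw [ContinuousLinearMap.comp_apply, hS, hS, tfShiftInv_tfShiftInv, smul_apply, map_smul,
      map_smul, smul_apply, hS]
  have h1 : ‖S (z + w)‖ₑ = ‖S z ∘L S w‖ₑ := by rw [h, enorm_smul, enorm_ex, one_mul]
  rw [h1]
  exact ContinuousLinearMap.opENorm_comp_le _ _

/-- Only the first factor carries the supremum. At `z = 0` this bounds `localSup S w` by a constant
times `‖S w‖`, hence by `v`, without any local regularity of `v`. -/
theorem localSup_add_le (hι : Function.Injective ι)
    (hS : ∀ z u φ, ι (S z u) φ = ι u (tfShiftInv z φ)) (z w : ℝ × ℝ) :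
    localSup S (z + w) ≤ localSup S z * ‖S w‖ₑ := by
  refine iSup₂_le fun y hy ↦ ?_
  have h1 : y - w ∈ Metric.ball z 1 := by
    rw [mem_ball_iff_norm] at hy ⊢
    rwa [show y - w - z = y - (z + w) by abel]
  have h2 := enorm_shift_add_le hι hS (y - w) w
  rw [sub_add_cancel] at h2
  refine h2.trans ?_
  gcongr
  exact le_iSup₂ (f := fun y (_ : y ∈ Metric.ball z 1) ↦ ‖S y‖ₑ) (y - w) h1

theorem isControlWeight_localSup [Nontrivial B] (hι : Function.Injective ι)
    (hS : ∀ z u φ, ι (S z u) φ = ι u (tfShiftInv z φ))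
    (hgrowth : ∃ (D : ℝ) (M : ℕ), 0 ≤ D ∧ ∀ z, ‖S z‖ ≤ D * (1 + ‖z‖) ^ M) :
    IsControlWeight (localSup S) where
  measurable := measurable_localSup S
  map_add_le z w := (localSup_add_le hι hS z w).trans (by
    gcongr
    exact enorm_le_localSup S w)
  one_le_zero := by
    have h : S 0 = ContinuousLinearMap.id ℂ B := by
      ext u
      refine hι ?_
      ext φ
      rw [hS, tfShiftInv_zero, ContinuousLinearMap.id_apply]
    refine le_trans ?_ (enorm_le_localSup S 0)
    rw [h, ← ofReal_norm, ContinuousLinearMap.norm_id, ENNReal.ofReal_one]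
  growth := by
    obtain ⟨D, M, hD, h⟩ := hgrowth
    refine ⟨D * 2 ^ M, M, by positivity, fun z ↦ iSup₂_le fun y hy ↦ ?_⟩
    rw [← ofReal_norm]
    refine ENNReal.ofReal_le_ofReal ((h y).trans ?_)
    rw [mul_assoc, ← mul_pow]
    gcongr
    rw [mem_ball_iff_norm] at hy
    have : ‖y‖ ≤ ‖y - z‖ + ‖z‖ := by simpa using norm_add_le (y - z) z
    linarith [norm_nonneg z]

end Operators

theorem HasPolynomialGrowth.exists_le (A : Params) {v : ℝ × ℝ → ℝ} (hv : HasPolynomialGrowth v) :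
    ∃ (D : ℝ) (M : ℕ), 0 ≤ D ∧
      ∀ z : ℝ × ℝ, v (z.1, A.a * z.1 - A.b * z.2) ≤ D * (1 + ‖z‖) ^ M := by
  obtain ⟨C, s, hC, hs, h⟩ := hv
  refine ⟨C * (2 + |A.a| + |A.b|) ^ ⌈s⌉₊, ⌈s⌉₊, by positivity, fun z ↦ (h _ _).trans ?_⟩
  rw [mul_assoc, ← mul_pow]
  gcongr
  have h1 : |z.1| ≤ ‖z‖ := norm_fst_le z
  have h2 : |z.2| ≤ ‖z‖ := norm_snd_le z
  have h3 : |A.a * z.1 - A.b * z.2| ≤ |A.a| * ‖z‖ + |A.b| * ‖z‖ := by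
    refine (abs_sub _ _).trans ?_
    rw [abs_mul, abs_mul]
    gcongr
  have h4 : 1 + |z.1| + |A.a * z.1 - A.b * z.2| ≤ (2 + |A.a| + |A.b|) * (1 + ‖z‖) := by
    nlinarith [abs_nonneg A.a, abs_nonneg A.b, norm_nonneg z]
  have h5 : 1 ≤ 1 + |z.1| + |A.a * z.1 - A.b * z.2| := by
    linarith [abs_nonneg z.1, abs_nonneg (A.a * z.1 - A.b * z.2)]
  calc (1 + |z.1| + |A.a * z.1 - A.b * z.2|) ^ s
      ≤ (1 + |z.1| + |A.a * z.1 - A.b * z.2|) ^ (⌈s⌉₊ : ℝ) :=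
        Real.rpow_le_rpow_of_exponent_le h5 (Nat.le_ceil s)
    _ = (1 + |z.1| + |A.a * z.1 - A.b * z.2|) ^ ⌈s⌉₊ := Real.rpow_natCast _ _
    _ ≤ _ := by gcongr

end SAFT

/-! ### Minimality of the modulation space. -/

theorem mainTheorem4
    (A : Params)
    -- the weight, and the window used in the definition of `M^1_{A,v} = M^{1,1}_{A,v}`
    (v : ℝ × ℝ → ℝ) (hv : IsWeight v) (hv_mod : IsModerate v) (hv_poly : HasPolynomialGrowth v)
    (g : 𝓢(ℝ, ℂ)) (hg : g ≠ 0)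
    -- a Banach space `B` continuously embedded by `ι` into the tempered distributions
    {B : Type*} [NormedAddCommGroup B] [NormedSpace ℂ B] [CompleteSpace B]
    (ι : B →L[ℂ] 𝓢'(ℝ, ℂ)) (hι : Function.Injective ι)
    -- `B` is invariant under `A`-time-frequency shifts, with norms controlled by `v`
    (hB : ∀ (u : B) (x ω : ℝ), ∃ w : B,
      ι w = modulationDist A ω (translationDist A x (ι u)) ∧ ‖w‖ ≤ v (x, ω) * ‖u‖)
    -- `M^1_{A,v}` and `B` have a non-zero element in common
    (hne : ∃ f ∈ modSpace A v g 1 1, f ∈ Set.range ι ∧ f ≠ 0) :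
    ∃ C : ℝ, 0 < C ∧ ∀ f ∈ modSpace A v g 1 1,
      ∃ u : B, ι u = f ∧ ‖u‖ ≤ C * (modNorm A v g 1 1 f).toReal := by
  obtain ⟨f₀, hf₀mod, ⟨u₀, rfl⟩, hf₀⟩ := hne
  have hb := A.b_ne_zero
  have hu₀ : u₀ ≠ 0 := fun h ↦ hf₀ (by rw [h, map_zero])
  have : Nontrivial B := ⟨u₀, 0, hu₀⟩
  have hB' : ∀ (u : B) (z : ℝ × ℝ), ∃ w : B, (∀ φ, ι w φ = ι u (tfShiftInv z φ)) ∧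
      ‖w‖ ≤ v (z.1, A.a * z.1 - A.b * z.2) * ‖u‖ := fun u z ↦ by
    obtain ⟨w, hw, hwn⟩ := hB u z.1 (A.a * z.1 - A.b * z.2)
    have hz : (z.1, (A.a * z.1 - (A.a * z.1 - A.b * z.2)) / A.b) = z := by
      ext
      · rfl
      · field_simp
        ring
    -- The unimodular factor between the `A`-shift and the ordinary shift; dividing by it preserves
    -- the norm.
    set c := phase 0 0 (Real.pi / A.b * (A.a * (A.a * z.1 - A.b * z.2) ^ 2 -
      2 * A.p * (A.a * z.1 - A.b * z.2) + 2 * A.a * z.1 ^ 2)) 0 with hc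
    refine ⟨c⁻¹ • w, fun φ ↦ ?_, ?_⟩
    · rw [map_smul, smul_apply, hw, modulationDist_translationDist_apply, ← hc, hz, smul_eq_mul,
        inv_mul_cancel_left₀ (phase_ne_zero _ _ _ _)]
    · rwa [norm_smul, norm_inv, norm_phase, inv_one, one_mul]
  obtain ⟨S, hS, hSv⟩ := exists_shift_operator hι (fun z ↦ (hv.pos _).le) hB'
  have hν : IsControlWeight (localSup S) := by
    obtain ⟨D, M, hD, h⟩ := hv_poly.exists_le A
    exact isControlWeight_localSup hι hS ⟨D, M, hD, fun z ↦ (hSv z).trans (h z)⟩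
  have hνv : ∀ z, localSup S z ≤
      localSup S 0 * ENNReal.ofReal (v (z.1, A.a * z.1 - A.b * z.2)) := fun z ↦ by
    have h := localSup_add_le hι hS 0 z
    rw [zero_add] at h
    refine h.trans ?_
    gcongr
    rw [← ofReal_norm]
    exact ENNReal.ofReal_le_ofReal (hSv z)
  obtain ⟨C₁, hC₁, h₁⟩ := exists_stftNorm_le_modNorm A hv.measurable g (hν.lt_top 0) hνv
  obtain ⟨γ, hγ⟩ := exists_integral_mul_eq_one (windowOf_ne_zero A hg)
  have hfin : ∀ f ∈ modSpace A v g 1 1, stftNorm (localSup S) (windowOf A g) f < ∞ :=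
    fun f hf ↦ (h₁ f).trans_lt (ENNReal.mul_lt_top hC₁ hf)
  obtain ⟨C₂, hC₂, h₂⟩ := exists_approx (ι := ι) (w := fun z ↦ S z u₀) (K₀ := ‖u₀‖ₑ) hν hγ
    (fun z φ ↦ hS z u₀ φ) (fun z ↦ by
      refine ((S z).le_opENorm u₀).trans ?_
      rw [mul_comm]
      gcongr
      exact enorm_le_localSup S z) (by finiteness) hf₀ (hfin _ hf₀mod)
  -- The factor `2` is the sum of the geometric series; the `+ 1` only secures strict positivity.
  refine ⟨2 * C₂.toReal * C₁.toReal + 1, by positivity, fun f hf ↦ ?_⟩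
  obtain ⟨u, hu, hun⟩ := exists_preimage_of_approx hν hγ hC₂ h₂ (hfin f hf)
  refine ⟨u, hu, hun.trans ?_⟩
  have h₃ := ENNReal.toReal_mono (ENNReal.mul_lt_top hC₁ hf).ne (h₁ f)
  rw [ENNReal.toReal_mul] at h₃
  calc _ ≤ 2 * C₂.toReal * (C₁.toReal * (modNorm A v g 1 1 f).toReal) := by gcongr
    _ ≤ _ := by nlinarith [ENNReal.toReal_nonneg (a := modNorm A v g 1 1 f)]
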